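/- Setting. Let $\nu\ge 3$, $\rho_0>0$, and for $L>0$ put $V=L^\nu$, $\Lambda_L^*=\frac{2\pi}{L}\mathbb Z^\nu$. Let $a_{L,k},a^*_{L,k}$ ($k\in\Lambda_L^*$) be boson annihilation and creation operators, and let $\omega$ be the ground state of the imperfect Bose gas with condensate density $\rho_0$ and phase $0$, i.e. the quasi-free state with $\omega(a_{L,0})=\omega(a_{L,0}^*)=\sqrt{\rho_0V}$, all other one-point functions zero, and truncated two-point functions $\omega^T(a_{L,k}a^*_{L,k'})=\delta_{k,k'}$, $\omega^T(a^*_{L,k}a_{L,k'})=\omega^T(a_{L,k}a_{L,k'})=\omega^T(a^*_{L,k}a^*_{L,k'})=0$; operators are taken in its GNS (displaced Fock) representation. Let $\mathcal F$ be the real vector space of continuous $f:\mathbb R^\nu\times\mathbb R^\nu\to\mathbb C$ with $f(\pm k,\pm k')=f(k,k')$ and $\overline{f(k,k')}=f(k',k)$. For $0\ne q\in\Lambda_L^*$ and functions $f,g$ of two momenta put $$\rho_{L,q}(f)=\frac1{2\sqrt{\rho_0V}}\sum_{k\in\Lambda_L^*}\bigl[f(k+q,k)a^*_{L,k+q}a_{L,k}+f(k-q,k)a^*_{L,k-q}a_{L,k}\bigr],$$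 $$A_{L,q}(g)=\tfrac i2\bigl[g(q,0)(a^*_{L,q}+a^*_{L,-q})-g(0,q)(a_{L,q}+a_{L,-q})\bigr],\qquad F_{L,q}(f,g)=\rho_{L,q}(f)+A_{L,q}(g).$$ For $0\neq q\in\mathbb R^\nu$, $\lim_{L\to\infty}u_{L,q}$ means the limit of $u_{L,q_L}$ as $L\to\infty$ along arbitrary $0\ne q_L\in\Lambda_L^*$ with $q_L\to q$; $\lim_{q\to0}$ is then taken over $q\ne0$. For $x_j=(f_j,g_j)\in\mathcal F\times\mathcal F$ put $$\langle x_1|x_2\rangle=\tfrac12\,\overline{(f_1(0,0)+ig_1(0,0))}\,(f_2(0,0)+ig_2(0,0))=s(x_1|x_2)+\tfrac i2\sigma(x_1|x_2)$$ with $s,\sigma$ real. Let $\tilde\omega$ be the quasi-free state $\tilde\omega(W(x))=e^{-\frac12 s(x|x)}$ on the CCR algebra generated by Weyl elements $W(x)$, $x\in\mathcal F\times\mathcal F$, with $W(x)^*=W(-x)$ and $W(x)W(y)=e^{-\frac i2\sigma(x|y)}W(x+y)$; let $\pi$ be its GNS representation, and let the macroscopic field $\Phi(x)$ be the generator of the one-parameter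 unitary group $t\mapsto\pi(W(tx))=e^{it\Phi(x)}$. For a family of symmetric operators $X_{L,q}$ write $\text{CLT-}\lim_{q\to0}\lim_{L\to\infty}X_{L,q}=\Phi(x)$ if, for all $n$, all $t_1,\dots,t_n\in\mathbb R$ and all $Y^{(1)},\dots,Y^{(n)}$, each of which is either the family $X_{L,q}$ (then put $y_j=x$) or a family $F_{L,q}(y_j)$ with $y_j\in\mathcal F\times\mathcal F$, $$\lim_{q\to0}\lim_{L\to\infty}\omega\bigl(e^{it_1Y^{(1)}_{L,q}}\cdots e^{it_nY^{(n)}_{L,q}}\bigr)=\tilde\omega\bigl(W(t_1y_1)\cdots W(t_ny_n)\bigr),$$ where the exponentials are formed with arbitrary self-adjoint extensions of the $Y^{(j)}_{L,q}$ from the finite linear combinations of occupation number vectors. Proposition. (a) For all $x,y\in\mathcal F\times\mathcal F$, $\lim_{q\to0}\lim_{L\to\infty}\omega(F_{L,q}(x)F_{L,q}(y))=\langle x|y\rangle$. (b) For all $f_1,g_1,f_2,g_2\in\mathcal F$: $\Phi(f_1,g_1)=\Phi(f_2,g_2)$ if and only if $$\lim_{q\to0}\lim_{L\to\infty}\omega\bigl(F_{L,q}(f_1-f_2,g_1-g_2)^2\bigr)=0.$$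 (c) For $f\in\mathcal F$ let $(Jf)(q,0)=-if(q,0)$ and $(Jf)(0,q)=if(0,q)$ for $q\ne0$, and $Jf=0$ at all other points. Then $\lim_{q\to0}\lim_{L\to\infty}\omega\bigl((\rho_{L,q}(f)-A_{L,q}(Jf))^2\bigr)=0$, and $$\text{CLT-}\lim_{q\to0}\lim_{L\to\infty}\rho_{L,q}(f)=\Phi(f,0)=\text{CLT-}\lim_{q\to0}\lim_{L\to\infty}A_{L,q}(Jf).$$ -/

import Mathlib

noncomputable section

namespace BoseFluctuation

open Filter Topology

/-! ## The Weyl algebra of the canonical commutation relations -/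

section CCR

variable {V : Type*} [AddCommGroup V] [Module ℝ V]

/-- The `*`-algebra of the canonical commutation relations over a real vector space `V` with
symplectic (that is, alternating, possibly degenerate) form `σ`: finite linear combinations
`∑ z_x W(x)` of Weyl elements, with `W(x) W(y) = exp (-(i/2) σ(x,y)) W(x+y)` and `W(x)^* = W(-x)`.
It is dense in the C*-algebra of the canonical commutation relations, so that a state and its
cyclic (GNS) representation are determined on it. -/
def CCR (_σ : V →ₗ[ℝ] V →ₗ[ℝ] ℝ) : Type _ := V →₀ ℂ

namespace CCR

variable (σ : V →ₗ[ℝ] V →ₗ[ℝ] ℝ)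

instance : AddCommGroup (CCR σ) := inferInstanceAs (AddCommGroup (V →₀ ℂ))
instance : Module ℂ (CCR σ) := inferInstanceAs (Module ℂ (V →₀ ℂ))

/-- The Weyl element `W(x)`. -/
def W (x : V) : CCR σ := Finsupp.single x (1 : ℂ)

/-- The linear map with prescribed values on the Weyl elements. -/
def lift {M : Type*} [AddCommGroup M] [Module ℂ M] (v : V → M) : CCR σ →ₗ[ℂ] M :=
  Finsupp.linearCombination ℂ v

theorem lift_W {M : Type*} [AddCommGroup M] [Module ℂ M] (v : V → M) (x : V) :
    lift σ v (W σ x) = v x :=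
  (Finsupp.linearCombination_single ℂ (1 : ℂ) x).trans (one_smul ℂ (v x))

/-- The phase in the Weyl relations. -/
def phase (x y : V) : ℂ := Complex.exp (-(Complex.I / 2) * (σ x y : ℂ))

/-- The product, bilinear with `W(x) W(y) = exp (-(i/2) σ(x,y)) W(x+y)`. -/
def mulMap : CCR σ →ₗ[ℂ] CCR σ →ₗ[ℂ] CCR σ :=
  lift σ fun x => lift σ fun y => phase σ x y • W σ (x + y)

instance : Mul (CCR σ) := ⟨fun a b => mulMap σ a b⟩
instance : One (CCR σ) := ⟨W σ 0⟩

variable {σ}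

theorem mul_def (a b : CCR σ) : a * b = mulMap σ a b := rfl

theorem one_def : (1 : CCR σ) = W σ 0 := rfl

theorem induction_on {p : CCR σ → Prop} (a : CCR σ) (zero : p 0)
    (add : ∀ a b, p a → p b → p (a + b)) (smul : ∀ (z : ℂ) (x : V), p (z • W σ x)) : p a := by
  refine Finsupp.induction_linear (motive := p) a zero (fun f g => add f g) fun x z => ?_
  have h : (Finsupp.single x z : V →₀ ℂ) = z • Finsupp.single x (1 : ℂ) := by simp
  have := smul z x
  rw [W] at this
  exact h ▸ this

theorem W_mul_W (x y : V) : W σ x * W σ y = phase σ x y • W σ (x + y) := by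
  rw [mul_def, mulMap, lift_W, lift_W]

theorem add_mul' (a b c : CCR σ) : (a + b) * c = a * c + b * c := by
  simp only [mul_def, map_add, LinearMap.add_apply]

theorem mul_add' (a b c : CCR σ) : a * (b + c) = a * b + a * c := by
  simp only [mul_def, map_add]

theorem smul_mul' (z : ℂ) (a b : CCR σ) : (z • a) * b = z • (a * b) := by
  simp only [mul_def, map_smul, LinearMap.smul_apply]

theorem mul_smul' (z : ℂ) (a b : CCR σ) : a * (z • b) = z • (a * b) := by
  simp only [mul_def, map_smul]

theorem zero_mul' (a : CCR σ) : 0 * a = 0 := by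
  simp only [mul_def, map_zero, LinearMap.zero_apply]

theorem mul_zero' (a : CCR σ) : a * 0 = 0 := by
  simp only [mul_def, map_zero]

theorem phase_cocycle (x y z : V) :
    phase σ x y * phase σ (x + y) z = phase σ y z * phase σ x (y + z) := by
  simp only [phase, ← Complex.exp_add, map_add, LinearMap.add_apply, Complex.ofReal_add]
  ring_nf

theorem mul_assoc' (a b c : CCR σ) : a * b * c = a * (b * c) := by
  induction a using induction_on with
  | zero => simp only [zero_mul']
  | add a₁ a₂ h₁ h₂ => simp only [add_mul', h₁, h₂]
  | smul s x =>
    induction b using induction_on with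
    | zero => simp only [zero_mul', mul_zero']
    | add a₁ a₂ h₁ h₂ => simp only [add_mul', mul_add', h₁, h₂]
    | smul t y =>
      induction c using induction_on with
      | zero => simp only [mul_zero']
      | add a₁ a₂ h₁ h₂ => simp only [mul_add', h₁, h₂]
      | smul u z =>
        simp only [smul_mul', mul_smul', W_mul_W, smul_smul, add_assoc]
        congr 1
        linear_combination s * t * u * phase_cocycle (σ := σ) x y z

theorem one_mul' (a : CCR σ) : 1 * a = a := by
  induction a using induction_on with
  | zero => exact mul_zero' _
  | add a₁ a₂ h₁ h₂ => rw [mul_add', h₁, h₂]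
  | smul s x => simp [one_def, mul_smul', W_mul_W, phase]

theorem mul_one' (a : CCR σ) : a * 1 = a := by
  induction a using induction_on with
  | zero => exact zero_mul' _
  | add a₁ a₂ h₁ h₂ => rw [add_mul', h₁, h₂]
  | smul s x => simp [one_def, smul_mul', W_mul_W, phase]

instance : Ring (CCR σ) :=
  { (inferInstance : AddCommGroup (CCR σ)) with
    mul := (· * ·)
    one := 1
    left_distrib := mul_add'
    right_distrib := add_mul'
    zero_mul := zero_mul'
    mul_zero := mul_zero'
    mul_assoc := mul_assoc'
    one_mul := one_mul'
    mul_one := mul_one' }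

instance : Algebra ℂ (CCR σ) := Algebra.ofModule smul_mul' mul_smul'

/-- The involution, conjugate linear with `W(x)^* = W(-x)`. -/
instance : Star (CCR σ) :=
  ⟨fun a => Finsupp.equivMapDomain (Equiv.neg V)
    (Finsupp.mapRange (starRingEnd ℂ) (map_zero _) (show V →₀ ℂ from a))⟩

theorem star_smul_W (z : ℂ) (x : V) :
    star (z • W σ x) = (starRingEnd ℂ z) • W σ (-x) := by
  change Finsupp.equivMapDomain (Equiv.neg V) (Finsupp.mapRange (starRingEnd ℂ) (map_zero _)
    (z • Finsupp.single x (1 : ℂ))) = (starRingEnd ℂ z) • Finsupp.single (-x) (1 : ℂ)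
  simp [Finsupp.equivMapDomain_single]

theorem star_add' (a b : CCR σ) : star (a + b) = star a + star b :=
  Finsupp.ext fun x => map_add (starRingEnd ℂ) ((show V →₀ ℂ from a) (-x)) _

theorem star_zero' : star (0 : CCR σ) = 0 :=
  Finsupp.ext fun _ => map_zero (starRingEnd ℂ)

theorem star_star' (a : CCR σ) : star (star a) = a := by
  induction a using induction_on with
  | zero => rw [star_zero', star_zero']
  | add a₁ a₂ h₁ h₂ => rw [star_add', star_add', h₁, h₂]
  | smul s x => simp [star_smul_W]

theorem star_W (x : V) : star (W σ x) = W σ (-x) := by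
  simpa using star_smul_W (σ := σ) 1 x

theorem star_smul' (z : ℂ) (a : CCR σ) : star (z • a) = (starRingEnd ℂ z) • star a := by
  induction a using induction_on with
  | zero => rw [smul_zero, star_zero', smul_zero]
  | add a₁ a₂ h₁ h₂ => rw [smul_add, star_add', star_add', smul_add, h₁, h₂]
  | smul s x => rw [smul_smul, star_smul_W, star_smul_W, smul_smul, map_mul]

variable [hσ : Fact σ.IsAlt]

theorem star_mul' (a b : CCR σ) : star (a * b) = star b * star a := by
  induction a using induction_on with
  | zero => rw [zero_mul', star_zero', mul_zero']
  | add a₁ a₂ h₁ h₂ => rw [add_mul', star_add', star_add', mul_add', h₁, h₂]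
  | smul s x =>
    induction b using induction_on with
    | zero => rw [mul_zero', star_zero', zero_mul']
    | add a₁ a₂ h₁ h₂ => rw [mul_add', star_add', star_add', add_mul', h₁, h₂]
    | smul t y =>
      have h : (starRingEnd ℂ) (phase σ x y) = phase σ y x := by
        rw [phase, phase, ← Complex.exp_conj, ← hσ.out.neg x y]
        congr 1
        simp [map_ofNat]
        ring
      have h' : phase σ (-y) (-x) = phase σ y x := by simp [phase]
      simp only [smul_mul', mul_smul', W_mul_W, smul_smul, star_smul_W, h', neg_add, map_mul, h]
      rw [add_comm (-x)]
      congr 1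
      ring

instance : StarRing (CCR σ) where
  star_involutive := star_star'
  star_mul := star_mul'
  star_add := star_add'

end CCR

end CCR

/-! ## Test functions and the limiting forms -/

/-- Momentum space. -/
abbrev Momentum (ν : ℕ) : Type := EuclideanSpace ℝ (Fin ν)

/-- The class `𝓕` of continuous complex functions of two momenta with
`f(±k, ±k') = f(k, k')` and `conj f(k, k') = f(k', k)`. -/
def TestFun (ν : ℕ) : Submodule ℝ (Momentum ν → Momentum ν → ℂ) where
  carrier := {f | Continuous (Function.uncurry f) ∧ (∀ k k', f (-k) k' = f k k') ∧
    (∀ k k', f k (-k') = f k k') ∧ ∀ k k', starRingEnd ℂ (f k k') = f k' k}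
  add_mem' := by
    rintro f g ⟨hf, hf₁, hf₂, hf₃⟩ ⟨hg, hg₁, hg₂, hg₃⟩
    refine ⟨hf.add hg, fun k k' => ?_, fun k k' => ?_, fun k k' => ?_⟩
    · simp [hf₁, hg₁]
    · simp [hf₂, hg₂]
    · simp [hf₃, hg₃]
  zero_mem' := ⟨continuous_const, by simp, by simp, by simp⟩
  smul_mem' := by
    rintro c f ⟨hf, hf₁, hf₂, hf₃⟩
    refine ⟨hf.const_smul c, fun k k' => ?_, fun k k' => ?_, fun k k' => ?_⟩
    · simp [hf₁]
    · simp [hf₂]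
    · simp [hf₃]

/-- The real space `(𝓕, 𝓕)` of pairs `(f, g)`. -/
abbrev Test (ν : ℕ) : Type := TestFun ν × TestFun ν

variable {ν : ℕ}

/-- `(f, g) ↦ f(0,0) + i g(0,0)`. -/
def amplitude : Test ν →ₗ[ℝ] ℂ where
  toFun x := x.1.1 0 0 + Complex.I * x.2.1 0 0
  map_add' x y := by simp; ring
  map_smul' c x := by simp; ring

/-- The form `⟨x | y⟩ = (1/2) conj (f₁(0,0) + i g₁(0,0)) (f₂(0,0) + i g₂(0,0))`. The main theorem
asserts that it is the limit `q → 0` after `L → ∞` of the two-point functions of the fluctuation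
operators. -/
def form (x y : Test ν) : ℂ := (1 / 2) * (starRingEnd ℂ (amplitude x) * amplitude y)

/-- The real part `s` of the form. -/
def symForm (x y : Test ν) : ℝ := (form x y).re

/-- The symplectic form `σ`, where `⟨x | y⟩ = s(x | y) + (i/2) σ(x | y)`. -/
def sympForm (ν : ℕ) : Test ν →ₗ[ℝ] Test ν →ₗ[ℝ] ℝ :=
  LinearMap.mk₂ ℝ (fun x y => 2 * (form x y).im)
    (fun x x' y => by simp [form]; ring) (fun c x y => by simp [form]; ring)
    (fun x y y' => by simp [form]; ring) (fun c x y => by simp [form]; ring)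

theorem sympForm_apply (x y : Test ν) : sympForm ν x y = 2 * (form x y).im := rfl

instance : Fact (sympForm ν).IsAlt :=
  ⟨fun x => by simp [sympForm_apply, form]; ring⟩

/-! ## The macroscopic state, its GNS representation and the fields -/

/-- The `*`-algebra of macroscopic fluctuations. -/
abbrev FluctAlg (ν : ℕ) : Type := CCR (sympForm ν)

/-- The Weyl element `W(f, g)`. -/
abbrev weyl (x : Test ν) : FluctAlg ν := CCR.W (sympForm ν) x

/-- The quasi-free functional `W(x) ↦ exp (-(1/2) s(x | x))`. -/
def macroState (ν : ℕ) : FluctAlg ν →ₗ[ℂ] ℂ :=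
  CCR.lift _ fun x => Complex.exp (-(1 / 2) * (symForm x x : ℂ))

theorem macroState_weyl (x : Test ν) :
    macroState ν (weyl x) = Complex.exp (-(1 / 2) * (symForm x x : ℂ)) := by
  rw [macroState, CCR.lift_W]

theorem macroState_star (a : FluctAlg ν) :
    macroState ν (star a) = starRingEnd ℂ (macroState ν a) := by
  induction a using CCR.induction_on with
  | zero => simp
  | add a b ha hb => rw [star_add, map_add, map_add, map_add, ha, hb]
  | smul z x =>
    rw [CCR.star_smul_W, map_smul, map_smul, macroState_weyl, macroState_weyl, smul_eq_mul,
      smul_eq_mul, map_mul, ← Complex.exp_conj]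
    congr 2
    simp [symForm, form, map_ofNat]

/-- The normalised moments used to see that the macroscopic functional is positive. -/
def moment (n : ℕ) : FluctAlg ν →ₗ[ℂ] ℂ :=
  CCR.lift _ fun x => Complex.exp (-(1 / 2) * (symForm x x : ℂ)) * amplitude x ^ n

theorem moment_weyl (n : ℕ) (x : Test ν) :
    moment n (weyl x) = Complex.exp (-(1 / 2) * (symForm x x : ℂ)) * amplitude x ^ n := by
  rw [moment, CCR.lift_W]

theorem hasSum_macroState (a b : FluctAlg ν) :
    HasSum (fun n : ℕ => ((1 / 2 : ℂ) ^ n / (n.factorial : ℂ)) *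
      (starRingEnd ℂ (moment n a) * moment n b)) (macroState ν (star a * b)) := by
  induction a using CCR.induction_on with
  | zero => simp
  | add a₁ a₂ h₁ h₂ =>
    rw [star_add, add_mul, map_add]
    refine (h₁.add h₂).congr_fun ?_
    intro n
    simp only [map_add]
    ring
  | smul s x =>
    induction b using CCR.induction_on with
    | zero => simp
    | add a₁ a₂ h₁ h₂ =>
      rw [mul_add, map_add]
      refine (h₁.add h₂).congr_fun ?_
      intro n
      simp only [map_add]
      ring
    | smul t y =>
      have h := (NormedSpace.expSeries_div_hasSum_exp
        ((1 / 2 : ℂ) * (starRingEnd ℂ (amplitude x) * amplitude y))).mul_left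
        (starRingEnd ℂ s * t * Complex.exp (-(1 / 2) * (symForm x x : ℂ)) *
          Complex.exp (-(1 / 2) * (symForm y y : ℂ)))
      rw [← Complex.exp_eq_exp_ℂ] at h
      have hx : starRingEnd ℂ (Complex.exp (-(1 / 2) * (symForm x x : ℂ))) =
          Complex.exp (-(1 / 2) * (symForm x x : ℂ)) := by
        rw [← Complex.exp_conj]
        simp [map_ofNat]
      have hv : macroState ν (star (s • CCR.W _ x) * (t • CCR.W _ y)) =
          starRingEnd ℂ s * t * Complex.exp (-(1 / 2) * (symForm x x : ℂ)) *
          Complex.exp (-(1 / 2) * (symForm y y : ℂ)) *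
          Complex.exp ((1 / 2 : ℂ) * (starRingEnd ℂ (amplitude x) * amplitude y)) := by
        rw [CCR.star_smul_W, smul_mul_assoc, mul_smul_comm, CCR.W_mul_W, map_smul, map_smul,
          map_smul, macroState_weyl, CCR.phase]
        simp only [smul_eq_mul, mul_assoc, ← Complex.exp_add]
        congr 3
        apply Complex.ext <;> simp [symForm, form, sympForm_apply] <;> ring
      rw [hv]
      refine h.congr_fun ?_
      intro n
      rw [(moment n).map_smul, (moment n).map_smul, moment_weyl, moment_weyl, smul_eq_mul,
        smul_eq_mul, map_mul, map_mul, hx, map_pow, mul_pow, mul_pow]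
      ring

theorem macroState_nonneg (a : FluctAlg ν) : 0 ≤ (macroState ν (star a * a)).re := by
  have h := (Complex.hasSum_iff _ _).1 (hasSum_macroState a a)
  refine h.1.nonneg fun n => ?_
  have e : ((1 / 2 : ℂ) ^ n / (n.factorial : ℂ)) * (starRingEnd ℂ (moment n a) * moment n a) =
      (((1 / 2 : ℝ) ^ n / (n.factorial : ℝ) * Complex.normSq (moment n a) : ℝ) : ℂ) := by
    rw [← Complex.normSq_eq_conj_mul_self]
    push_cast
    ring
  rw [e, Complex.ofReal_re]
  have := Complex.normSq_nonneg (moment n a)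
  positivity

/-- The algebra of macroscopic fluctuations with the semi-inner product
`⟨a, b⟩ = ω̃(a^* b)` of the macroscopic state. -/
def PreGNS (ν : ℕ) : Type := FluctAlg ν

instance : AddCommGroup (PreGNS ν) := inferInstanceAs (AddCommGroup (FluctAlg ν))
instance : Module ℂ (PreGNS ν) := inferInstanceAs (Module ℂ (FluctAlg ν))

/-- The identity map from the algebra to the pre-Hilbert space. -/
def toPreGNS : FluctAlg ν ≃ₗ[ℂ] PreGNS ν := LinearEquiv.refl ℂ _

/-- The semi-inner product of the GNS construction. -/
abbrev preGNSCore (ν : ℕ) : PreInnerProductSpace.Core ℂ (PreGNS ν) where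
  inner a b := macroState ν (star (toPreGNS.symm a) * toPreGNS.symm b)
  conj_inner_symm a b := by rw [← macroState_star, star_mul, star_star]
  re_inner_nonneg a := macroState_nonneg _
  add_left a b c := by rw [map_add, star_add, add_mul, map_add]
  smul_left a b z := by
    rw [map_smul, CCR.star_smul', smul_mul_assoc, map_smul, smul_eq_mul]

instance : SeminormedAddCommGroup (PreGNS ν) :=
  InnerProductSpace.Core.toSeminormedAddCommGroup (c := preGNSCore ν)
instance : InnerProductSpace ℂ (PreGNS ν) := InnerProductSpace.ofCore (preGNSCore ν)

/-- The GNS Hilbert space of the macroscopic state. -/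
abbrev GNS (ν : ℕ) : Type := UniformSpace.Completion (PreGNS ν)

/-- Left multiplication by `a` on the pre-Hilbert space. -/
def leftMul (a : FluctAlg ν) : PreGNS ν →ₗ[ℂ] PreGNS ν :=
  toPreGNS.toLinearMap ∘ₗ LinearMap.mulLeft ℂ a ∘ₗ toPreGNS.symm.toLinearMap

theorem leftMul_weyl_norm (x : Test ν) (b : PreGNS ν) : ‖leftMul (weyl x) b‖ = ‖b‖ := by
  have h : star (weyl x) * weyl x = 1 := by
    have h0 : sympForm ν (-x) x = 0 := by
      rw [map_neg, LinearMap.neg_apply, (Fact.out : (sympForm ν).IsAlt) x, neg_zero]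
    rw [CCR.star_W, CCR.W_mul_W, CCR.phase, h0, CCR.one_def]
    simp
  change √(macroState ν (star (weyl x * toPreGNS.symm b) * (weyl x * toPreGNS.symm b))).re =
    √(macroState ν (star (toPreGNS.symm b) * toPreGNS.symm b)).re
  rw [star_mul, mul_assoc, ← mul_assoc (star (weyl x)), h, one_mul]

theorem leftMul_bound (a : FluctAlg ν) : ∃ C, ∀ b : PreGNS ν, ‖leftMul a b‖ ≤ C * ‖b‖ := by
  induction a using CCR.induction_on with
  | zero =>
    refine ⟨0, fun b => ?_⟩
    have : leftMul (0 : FluctAlg ν) b = 0 := by simp [leftMul]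
    simp [this]
  | add a₁ a₂ h₁ h₂ =>
    obtain ⟨C₁, h₁⟩ := h₁
    obtain ⟨C₂, h₂⟩ := h₂
    refine ⟨C₁ + C₂, fun b => ?_⟩
    have : leftMul (a₁ + a₂) b = leftMul a₁ b + leftMul a₂ b := by simp [leftMul, add_mul]
    rw [this, add_mul]
    exact (norm_add_le _ _).trans (add_le_add (h₁ b) (h₂ b))
  | smul z x =>
    refine ⟨‖z‖, fun b => ?_⟩
    have : leftMul (z • weyl x) b = z • leftMul (weyl x) b := by simp [leftMul]
    rw [this, norm_smul, leftMul_weyl_norm]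

/-- The GNS representation `π`: `π(a)` is the continuous extension of left multiplication
by `a`. -/
def gnsRep (a : FluctAlg ν) : GNS ν →L[ℂ] GNS ν :=
  ((leftMul a).mkContinuousOfExistsBound (leftMul_bound a)).completion

/-- The macroscopic field `Φ(x)`, `x = (f, g)`: the self-adjoint operator with
`π(W(t x)) = exp (i t Φ(x))` for all real `t`, that is, the generator of this one-parameter unitary
group. Its domain consists of the `ψ` for which `t ↦ π(W(t x)) ψ` is differentiable
at `0`, and there `Φ(x) ψ = -i (d/dt) π(W(t x)) ψ` at `t = 0`. -/
def field (x : Test ν) : GNS ν →ₗ.[ℂ] GNS ν where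
  domain :=
    { carrier := {ψ | DifferentiableAt ℝ (fun t : ℝ => gnsRep (weyl (t • x)) ψ) 0}
      add_mem' := fun {ψ φ} hψ hφ => by
        simpa only [Set.mem_ofPred_eq, map_add] using DifferentiableAt.fun_add hψ hφ
      zero_mem' := by simp
      smul_mem' := fun z ψ hψ => by
        simpa only [Set.mem_ofPred_eq, map_smul] using DifferentiableAt.fun_const_smul hψ z }
  toFun :=
    { toFun := fun ψ =>
        -Complex.I • deriv (fun t : ℝ => gnsRep (weyl (t • x)) (ψ : GNS ν)) 0
      map_add' := fun ψ φ => by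
        simp only [Submodule.coe_add, map_add]
        rw [deriv_fun_add ψ.2 φ.2, smul_add]
      map_smul' := fun z ψ => by
        simp only [Submodule.coe_smul, map_smul, RingHom.id_apply]
        rw [deriv_fun_const_smul z ψ.2, smul_comm] }

/-! ## The Bose gas in its ground state

The modes of the box of side `L` are labelled by `n ∈ ℤ^ν`; the mode `n` has momentum
`k = 2 π n / L`. The ground state at condensate density `ρ₀` and phase `0` is the quasi-free state
with `ω(a_0) = ω(a_0^*) = √(ρ₀ V)`, `V = L ^ ν`, all other one-point functions zero, and truncated
two-point functions `ω^T(a_k a_k'^*) = δ_{k,k'}` and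
`ω^T(a_k^* a_k') = ω^T(a_k a_k') = ω^T(a_k^* a_k'^*) = 0`. Its GNS representation is the Fock
representation with `a_k = b_k + δ_{k,0} √(ρ₀ V)`, where the `b_k` annihilate the cyclic vector. -/

/-- Labels of the modes of the box. -/
abbrev Mode (ν : ℕ) : Type := Fin ν → ℤ

/-- The momentum `2 π n / L` of the mode `n` of the box of side `L`. -/
def momentum (L : ℝ) (n : Mode ν) : Momentum ν :=
  WithLp.toLp 2 fun i => 2 * Real.pi / L * (n i : ℝ)

/-- Finite linear combinations of the normalised occupation number vectors `|n⟩`. -/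
abbrev FinFock (ν : ℕ) : Type := (Mode ν →₀ ℕ) →₀ ℂ

/-- The annihilation operator of the Fock representation, `b_k |n⟩ = √n_k |n - δ_k⟩`. -/
def fockAnn (k : Mode ν) : Module.End ℂ (FinFock ν) :=
  Finsupp.linearCombination ℂ fun n =>
    Finsupp.single (n - Finsupp.single k 1) ((√(n k : ℝ) : ℝ) : ℂ)

/-- The creation operator of the Fock representation, `b_k^* |n⟩ = √(n_k + 1) |n + δ_k⟩`. -/
def fockCre (k : Mode ν) : Module.End ℂ (FinFock ν) :=
  Finsupp.linearCombination ℂ fun n =>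
    Finsupp.single (n + Finsupp.single k 1) ((√((n k : ℝ) + 1) : ℝ) : ℂ)

/-- The condensate amplitude: `√(ρ₀ V)` for the mode `0`, and `0` for all others. -/
def condensate (ρ₀ L : ℝ) (k : Mode ν) : ℂ :=
  if k = 0 then ((√(ρ₀ * L ^ ν) : ℝ) : ℂ) else 0

/-- The annihilation operator `a_{L,k}`. -/
def ann (ρ₀ L : ℝ) (k : Mode ν) : Module.End ℂ (FinFock ν) :=
  fockAnn k + condensate ρ₀ L k • 1

/-- The creation operator `a^*_{L,k}`. -/
def cre (ρ₀ L : ℝ) (k : Mode ν) : Module.End ℂ (FinFock ν) :=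
  fockCre k + condensate ρ₀ L k • 1

/-- The cyclic vector of the ground state. -/
def vacuum (ν : ℕ) : FinFock ν := Finsupp.single 0 1

/-- The ground state expectation `ω(X)` of a polynomial `X` in the creation and annihilation
operators (of the box under consideration). -/
def groundState (X : Module.End ℂ (FinFock ν)) : ℂ := X (vacuum ν) 0

/-- A box size `L` and the label `m` of the momentum `q = 2 π m / L`. -/
abbrev BoxMode (ν : ℕ) : Type := ℝ × Mode ν

/-- A function of two momenta. -/
abbrev Kernel (ν : ℕ) : Type := Momentum ν → Momentum ν → ℂ

/-- `ρ_{L,q}(f) = (1 / (2 √(ρ₀ V))) ∑_k [f(k+q,k) a^*_{k+q} a_k + f(k-q,k) a^*_{k-q} a_k]`.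
On `|n⟩` only the terms with `k = 0` or `n_k ≠ 0` of the sum over all modes `k` are nonzero. -/
def densityFluct (ρ₀ : ℝ) (f : Kernel ν) (p : BoxMode ν) : Module.End ℂ (FinFock ν) :=
  Finsupp.linearCombination ℂ fun n =>
    ((1 / (2 * √(ρ₀ * p.1 ^ ν)) : ℝ) : ℂ) • ∑ k ∈ insert 0 n.support,
      (f (momentum p.1 (k + p.2)) (momentum p.1 k) • cre ρ₀ p.1 (k + p.2) * ann ρ₀ p.1 k +
        f (momentum p.1 (k - p.2)) (momentum p.1 k) • cre ρ₀ p.1 (k - p.2) * ann ρ₀ p.1 k)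
        (Finsupp.single n (1 : ℂ))

/-- `A_{L,q}(g) = (i/2) [g(q,0) (a^*_q + a^*_{-q}) - g(0,q) (a_q + a_{-q})]`. -/
def orderFluct (ρ₀ : ℝ) (g : Kernel ν) (p : BoxMode ν) : Module.End ℂ (FinFock ν) :=
  (Complex.I / 2) • (g (momentum p.1 p.2) 0 • (cre ρ₀ p.1 p.2 + cre ρ₀ p.1 (-p.2)) -
    g 0 (momentum p.1 p.2) • (ann ρ₀ p.1 p.2 + ann ρ₀ p.1 (-p.2)))

/-- `F_{L,q}(f, g) = ρ_{L,q}(f) + A_{L,q}(g)`. -/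
def fluct (ρ₀ : ℝ) (x : Test ν) (p : BoxMode ν) : Module.End ℂ (FinFock ν) :=
  densityFluct ρ₀ x.1.1 p + orderFluct ρ₀ x.2.1 p

open Classical in
/-- `(Jf)(q,0) = -i f(q,0)` and `(Jf)(0,q) = i f(0,q)` for `q ≠ 0`, and `Jf = 0` at all other
points. -/
def J (f : Kernel ν) : Kernel ν := fun k k' =>
  if k ≠ 0 ∧ k' = 0 then -Complex.I * f k 0
  else if k = 0 ∧ k' ≠ 0 then Complex.I * f 0 k' else 0

/-! ## Limits -/

/-- The thermodynamic limit `L → ∞`, along momenta `q_L = 2 π m_L / L` of the box with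
`q_L → q`. -/
def thermo (q : Momentum ν) : Filter (BoxMode ν) :=
  comap (fun p : BoxMode ν => (p.1, momentum p.1 p.2)) (atTop ×ˢ 𝓝 q)

/-- `lim_{q → 0} lim_{L → ∞} u_{L,q} = c`: the inner limit exists for every `q ≠ 0`, and the limit
`q → 0` of its values is `c`. -/
def IteratedLim (u : BoxMode ν → ℂ) (c : ℂ) : Prop :=
  ∃ v : Momentum ν → ℂ, (∀ q, q ≠ 0 → Tendsto u (thermo q) (𝓝 (v q))) ∧
    Tendsto v (𝓝[≠] 0) (𝓝 c)

/-- The Fock space, with the vectors `|n⟩` as orthonormal basis. -/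
abbrev Fock (ν : ℕ) : Type := lp (fun _ : Mode ν →₀ ℕ => ℂ) 2

open Classical in
/-- The inclusion of the finite linear combinations of the `|n⟩` into Fock space. -/
def toFock : FinFock ν →ₗ[ℂ] Fock ν :=
  Finsupp.linearCombination ℂ fun n => lp.single 2 n (1 : ℂ)

/-- `U` is a strongly continuous one-parameter unitary group whose (self-adjoint) generator
extends the symmetric operator `X`. By Stone's theorem this says that `U t = exp (i t X')` for a
self-adjoint extension `X'` of `X`; the extension, and `U`, is unique when `X` is essentially
self-adjoint. -/
structure IsExp (X : Module.End ℂ (FinFock ν)) (U : ℝ → Fock ν →L[ℂ] Fock ν) : Prop where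
  mem_unitary : ∀ t, U t ∈ unitary (Fock ν →L[ℂ] Fock ν)
  map_add : ∀ s t, U (s + t) = U s * U t
  continuous : ∀ ψ, Continuous fun t => U t ψ
  generator : ∀ φ, HasDerivAt (fun t => U t (toFock φ)) (Complex.I • toFock (X φ)) 0

/-- `CLT-lim_{q → 0} lim_{L → ∞} X_{L,q} = Φ(x)`: for every word `Y₁, …, Yₙ` whose letters are `X`
(encoded as `none`) or fluctuations `F(y)` (encoded as `some y`), and all real `t₁, …, tₙ`,
`lim_{q → 0} lim_{L → ∞} ω(exp (i t₁ Y₁) ⋯ exp (i tₙ Yₙ)) = ω̃(W(t₁ y₁) ⋯ W(tₙ yₙ))`, where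
`yⱼ` is `x` for the letter `X` and `y` for the letter `F(y)`. -/
def IsCLTLimit (ρ₀ : ℝ) (X : BoxMode ν → Module.End ℂ (FinFock ν)) (x : Test ν) : Prop :=
  ∀ (n : ℕ) (y : Fin n → Option (Test ν)) (t : Fin n → ℝ)
    (U : Fin n → BoxMode ν → ℝ → Fock ν →L[ℂ] Fock ν),
    (∀ j p, 0 < p.1 → p.2 ≠ 0 → IsExp (((y j).elim X (fluct ρ₀)) p) (U j p)) →
    IteratedLim
      (fun p => inner ℂ (toFock (vacuum ν))
        ((List.ofFn fun j => U j p (t j)).prod (toFock (vacuum ν))))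
      (macroState ν (List.ofFn fun j => weyl (t j • (y j).getD x)).prod)

end BoseFluctuation

end

open BoseFluctuation

noncomputable section

namespace BoseFluctuation

open Filter Topology

variable {ν : ℕ}

/-! ## Algebra of the Fock operators -/

/-! Since `q ≠ 0`, only the mode `0` carries a condensate amplitude `c = √(ρ₀ V)`. Inserting `a_k =
b_k + δ_{k,0} c` into the density fluctuation gives two pieces (`densityFluct_eq`). The terms with
one index at `0` yield the linear operator `½ (z (b*_q + b*_{-q}) + conj z (b_q + b_{-q}))` with `z
= f(q,0)`. The remaining quadratic hopping term keeps the prefactor `1 / (2c)`. The order parameter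
fluctuation is linear already, with `z = i g(q,0)`. Hence `F(f,g)` is governed by `f(q,0) + i
g(q,0)`, and `J` is chosen so that `i (Jf)(q,0) = f(q,0)`.

Hopping annihilates the vacuum and its range has no vacuum component, so the two-point functions are
already exact in finite volume (`groundState_fluct_mul_fluct`). Only the continuity of the test
functions is needed for the limits.

For the central limit theorem the exponentials come from arbitrary self-adjoint extensions, known
only through their action on finite vectors. They are therefore compared with an explicit path: a
linear Hamiltonian moves coherent vectors `a exp(w (b*_q + b*_{-q})) Ω` along an explicit curve of
parameters `(a, w)`. Truncated at `N` particles, this path is finite and solves the equation of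
motion up to boundary terms, small for large `N` uniformly in the box, and a hopping term that
vanishes as `L → ∞` at fixed `N` (`IsExp.norm_path_sub_le`, `cohVec_defect`, `tendsto_hopping`).
Induction along the word gives `tendsto_inner_word`. The Weyl relations and the macroscopic state
obey the same recursion for `(a, w)` (`macroState_word`).

For the fields, `⟨x | x⟩` vanishes exactly when the amplitude of `x` does. The Weyl operators, hence
the field, depend on `x` only through its amplitude (`field_congr`). Conversely the cyclic vector
lies in the domain of every field, and pairing the field applied to it with Weyl vectors recovers
the form (`inner_deriv_weylVec`), which separates amplitudes. -/

theorem fockAnn_single (k : Mode ν) (n : Mode ν →₀ ℕ) :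
    fockAnn k (Finsupp.single n 1) =
      Finsupp.single (n - Finsupp.single k 1) ((√(n k : ℝ) : ℝ) : ℂ) := by
  simp [fockAnn]

theorem fockCre_single (k : Mode ν) (n : Mode ν →₀ ℕ) :
    fockCre k (Finsupp.single n 1) =
      Finsupp.single (n + Finsupp.single k 1) ((√((n k : ℝ) + 1) : ℝ) : ℂ) := by
  simp [fockCre]

theorem single_eq_smul (n : Mode ν →₀ ℕ) (c : ℂ) :
    (Finsupp.single n c : FinFock ν) = c • Finsupp.single n 1 := by simp

theorem fockAnn_single_of_eq_zero {k : Mode ν} {n : Mode ν →₀ ℕ} (h : n k = 0) :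
    fockAnn k (Finsupp.single n 1) = 0 := by
  rw [fockAnn_single, h]; simp

theorem end_ext {X Y : Module.End ℂ (FinFock ν)}
    (h : ∀ n, X (Finsupp.single n 1) = Y (Finsupp.single n 1)) : X = Y := by
  refine Finsupp.lhom_ext fun n c => ?_
  rw [single_eq_smul, map_smul, map_smul, h]

theorem fockAnn_mul_fockCre (k : Mode ν) :
    fockAnn k * fockCre k = fockCre k * fockAnn k + 1 := by
  refine end_ext fun n => ?_
  simp only [Module.End.mul_apply, LinearMap.add_apply, Module.End.one_apply]
  rw [fockCre_single, single_eq_smul, map_smul, fockAnn_single, fockAnn_single,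
    single_eq_smul (n - _), map_smul, fockCre_single]
  rcases Nat.eq_zero_or_pos (n k) with h | h
  · simp [h]
  · have h1 : n - Finsupp.single k 1 + Finsupp.single k 1 = n :=
      tsub_add_cancel_of_le (Finsupp.single_le_iff.2 h)
    have h2 : (((n k - 1 : ℕ) : ℝ) + 1) = n k := by
      rw [Nat.cast_sub h]; push_cast; ring
    simp only [Finsupp.add_apply, Finsupp.single_eq_same, Finsupp.tsub_apply, h1, h2,
      add_tsub_cancel_right, Finsupp.smul_single, smul_eq_mul, Nat.cast_add, Nat.cast_one,
      ← Complex.ofReal_mul]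
    rw [Real.mul_self_sqrt (by positivity), Real.mul_self_sqrt (by positivity),
      ← Finsupp.single_add]
    push_cast
    rfl

theorem fockAnn_mul_fockCre_of_ne {k l : Mode ν} (hkl : k ≠ l) :
    fockAnn k * fockCre l = fockCre l * fockAnn k := by
  refine end_ext fun n => ?_
  simp only [Module.End.mul_apply]
  rw [fockCre_single, single_eq_smul, map_smul, fockAnn_single, fockAnn_single,
    single_eq_smul (n - _), map_smul, fockCre_single]
  have h0 : (n + Finsupp.single l 1 : Mode ν →₀ ℕ) k = n k := by simp [hkl]
  have h0' : (n - Finsupp.single k 1 : Mode ν →₀ ℕ) l = n l := by simp [hkl.symm]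
  rw [h0, h0']
  rcases Nat.eq_zero_or_pos (n k) with h | h
  · simp [h]
  · have h1 : n + Finsupp.single l 1 - Finsupp.single k 1 =
        n - Finsupp.single k 1 + Finsupp.single l 1 :=
      tsub_add_eq_add_tsub (Finsupp.single_le_iff.2 h) |>.symm
    rw [h1]
    simp [mul_comm]

theorem fockCre_apply_zero (k : Mode ν) (φ : FinFock ν) : fockCre k φ 0 = 0 := by
  induction φ using Finsupp.induction_linear with
  | zero => simp
  | add φ ψ h₁ h₂ => rw [map_add, Finsupp.add_apply, h₁, h₂, add_zero]
  | single n c =>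
    have h : n + Finsupp.single k 1 ≠ 0 := fun h => by simpa using DFunLike.congr_fun h k
    rw [single_eq_smul, map_smul, fockCre_single, Finsupp.smul_apply,
      Finsupp.single_eq_of_ne h.symm, smul_zero]

/-- `b^*_m + b^*_{-m}`. -/
def pairCre (m : Mode ν) : Module.End ℂ (FinFock ν) := fockCre m + fockCre (-m)

/-- `b_m + b_{-m}`. -/
def pairAnn (m : Mode ν) : Module.End ℂ (FinFock ν) := fockAnn m + fockAnn (-m)

/-- The vectors `(b^*_m + b^*_{-m})^n Ω`. -/
def pairVec (m : Mode ν) (n : ℕ) : FinFock ν := (pairCre m ^ n) (vacuum ν)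

theorem pairVec_zero (m : Mode ν) : pairVec m 0 = vacuum ν := by simp [pairVec]

theorem pairVec_succ (m : Mode ν) (n : ℕ) :
    pairVec m (n + 1) = pairCre m (pairVec m n) := by
  simp [pairVec, pow_succ']

theorem neg_ne_self_of_ne_zero {m : Mode ν} (hm : m ≠ 0) : -m ≠ m := by
  intro h
  apply hm
  funext i
  have := congrFun h i
  simp only [Pi.neg_apply] at this
  simp only [Pi.zero_apply]
  omega

/-- The modes `m` and `-m` are distinct, so the cross commutators vanish and the two diagonal ones
add up to `2`. From here on the pair behaves as a single oscillator. -/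
theorem pairAnn_mul_pairCre {m : Mode ν} (hm : m ≠ 0) :
    pairAnn m * pairCre m = pairCre m * pairAnn m + (2 : ℂ) • 1 := by
  have h := neg_ne_self_of_ne_zero hm
  simp only [pairAnn, pairCre, add_mul, mul_add, fockAnn_mul_fockCre,
    fockAnn_mul_fockCre_of_ne h, fockAnn_mul_fockCre_of_ne h.symm, two_smul]
  abel

theorem pairAnn_vacuum (m : Mode ν) : pairAnn m (vacuum ν) = 0 := by
  rw [vacuum, pairAnn, LinearMap.add_apply, fockAnn_single_of_eq_zero rfl,
    fockAnn_single_of_eq_zero rfl, add_zero]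

theorem pairAnn_pairVec_succ {m : Mode ν} (hm : m ≠ 0) (n : ℕ) :
    pairAnn m (pairVec m (n + 1)) = (2 * (n + 1 : ℂ)) • pairVec m n := by
  have key : ∀ φ, pairAnn m (pairCre m φ) = pairCre m (pairAnn m φ) + (2 : ℂ) • φ := fun φ => by
    simpa using LinearMap.congr_fun (pairAnn_mul_pairCre hm) φ
  induction n with
  | zero => rw [pairVec_succ, key, pairVec_zero, pairAnn_vacuum]; simp
  | succ n ih =>
    rw [pairVec_succ, key, ih, map_smul, ← pairVec_succ, ← add_smul]
    congr 1
    push_cast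
    ring

/-! ## Decomposition of the fluctuation operators -/

theorem momentum_zero (L : ℝ) : momentum L (0 : Mode ν) = 0 := by
  ext i; simp [momentum]

theorem momentum_neg (L : ℝ) (m : Mode ν) : momentum L (-m) = -momentum L m := by
  ext i; simp [momentum]

theorem momentum_add (L : ℝ) (m n : Mode ν) :
    momentum L (m + n) = momentum L m + momentum L n := by
  ext i; simp [momentum, mul_add]

/-- The part of the density fluctuation that is quadratic in the operators of the Fock
representation. -/
def hopping (ρ₀ : ℝ) (f : Kernel ν) (p : BoxMode ν) : Module.End ℂ (FinFock ν) :=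
  Finsupp.linearCombination ℂ fun n =>
    ((1 / (2 * √(ρ₀ * p.1 ^ ν)) : ℝ) : ℂ) • ∑ k ∈ insert 0 n.support,
      (f (momentum p.1 (k + p.2)) (momentum p.1 k) • (fockCre (k + p.2) * fockAnn k) +
        f (momentum p.1 (k - p.2)) (momentum p.1 k) • (fockCre (k - p.2) * fockAnn k))
        (Finsupp.single n (1 : ℂ))

theorem hopping_single (ρ₀ : ℝ) (f : Kernel ν) (p : BoxMode ν) (n : Mode ν →₀ ℕ) :
    hopping ρ₀ f p (Finsupp.single n 1) =
    ((1 / (2 * √(ρ₀ * p.1 ^ ν)) : ℝ) : ℂ) • ∑ k ∈ insert 0 n.support,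
      (f (momentum p.1 (k + p.2)) (momentum p.1 k) • (fockCre (k + p.2) * fockAnn k) +
        f (momentum p.1 (k - p.2)) (momentum p.1 k) • (fockCre (k - p.2) * fockAnn k))
        (Finsupp.single n (1 : ℂ)) := by
  simp [hopping]

theorem hopping_vacuum (ρ₀ : ℝ) (f : Kernel ν) (p : BoxMode ν) :
    hopping ρ₀ f p (vacuum ν) = 0 := by
  rw [vacuum, hopping_single]
  simp [fockAnn_single_of_eq_zero]

/-- Every hopping term ends with a creation operator, whose range has no vacuum component. -/
theorem hopping_apply_zero (ρ₀ : ℝ) (f : Kernel ν) (p : BoxMode ν) (φ : FinFock ν) :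
    hopping ρ₀ f p φ 0 = 0 := by
  induction φ using Finsupp.induction_linear with
  | zero => simp
  | add φ ψ h₁ h₂ => rw [map_add, Finsupp.add_apply, h₁, h₂, add_zero]
  | single n c =>
    rw [single_eq_smul, map_smul, hopping_single]
    simp only [Finsupp.smul_apply, Finsupp.finsetSum_apply, LinearMap.add_apply,
      LinearMap.smul_apply, Module.End.mul_apply, Finsupp.add_apply, fockCre_apply_zero]
    simp

/-- The linear term with amplitude `z`. -/
def linearFluct (z : ℂ) (m : Mode ν) : Module.End ℂ (FinFock ν) :=
  (1 / 2 : ℂ) • (z • pairCre m + starRingEnd ℂ z • pairAnn m)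

theorem linearFluct_add (z w : ℂ) (m : Mode ν) :
    linearFluct (z + w) m = linearFluct z m + linearFluct w m := by
  simp only [linearFluct, map_add, add_smul, smul_add]
  abel

/-- Hermiticity is asked only at the one pair of arguments that occurs, so that the lemma also
applies to `J f`, which need not be continuous. -/
theorem orderFluct_eq (ρ₀ : ℝ) {g : Kernel ν} {p : BoxMode ν} (hp : p.2 ≠ 0)
    (hg : g 0 (momentum p.1 p.2) = starRingEnd ℂ (g (momentum p.1 p.2) 0)) :
    orderFluct ρ₀ g p = linearFluct (Complex.I * g (momentum p.1 p.2) 0) p.2 := by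
  simp only [orderFluct, linearFluct, cre, ann, condensate, hp, neg_eq_zero, if_false, zero_smul,
    add_zero, hg, pairCre, pairAnn, map_mul, Complex.conj_I]
  module

theorem densityFluct_eq {ρ₀ : ℝ} (hρ₀ : 0 < ρ₀) (f : TestFun ν) {p : BoxMode ν} (hL : 0 < p.1)
    (hp : p.2 ≠ 0) :
    densityFluct ρ₀ f.1 p =
      linearFluct (f.1 (momentum p.1 p.2) 0) p.2 + hopping ρ₀ f.1 p := by
  refine end_ext fun n => ?_
  have hc : (√(ρ₀ * p.1 ^ ν) : ℂ) ≠ 0 := by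
    rw [Complex.ofReal_ne_zero]; positivity
  obtain ⟨f, -, hf₁, hf₂, hf₃⟩ := f
  set q := momentum p.1 p.2 with hq
  set c : ℂ := (√(ρ₀ * p.1 ^ ν) : ℂ) with hc'
  -- The mode `l` may be missing from the range of summation, but then it is unoccupied and `b_l`
  -- kills the vector anyway.
  have sum_ite : ∀ (l : Mode ν) (z : ℂ), ∑ k ∈ insert 0 n.support,
      (if k = l then z • fockAnn k (Finsupp.single n (1 : ℂ)) else 0) =
        z • fockAnn l (Finsupp.single n (1 : ℂ)) := fun l z => by
    rw [Finset.sum_ite_eq']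
    split_ifs with h
    · rfl
    · rw [fockAnn_single_of_eq_zero, smul_zero]
      by_contra h'
      exact h (Finset.mem_insert_of_mem (Finsupp.mem_support_iff.2 h'))
  have sum_zero : ∀ v : FinFock ν, ∑ k ∈ insert 0 n.support, (if k = 0 then v else 0) = v :=
    fun v => by rw [Finset.sum_ite_eq', if_pos (Finset.mem_insert_self _ _)]
  -- The condensate enters through the annihilator at `k = 0` and through the creator at `k = ±q`.
  -- These cases exclude each other because `q ≠ 0`, so no term in `c ^ 2` appears.
  have term : ∀ k, (f (momentum p.1 (k + p.2)) (momentum p.1 k) •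
        cre ρ₀ p.1 (k + p.2) * ann ρ₀ p.1 k +
      f (momentum p.1 (k - p.2)) (momentum p.1 k) • cre ρ₀ p.1 (k - p.2) * ann ρ₀ p.1 k)
        (Finsupp.single n (1 : ℂ)) =
      (f (momentum p.1 (k + p.2)) (momentum p.1 k) • (fockCre (k + p.2) * fockAnn k) +
        f (momentum p.1 (k - p.2)) (momentum p.1 k) • (fockCre (k - p.2) * fockAnn k))
        (Finsupp.single n (1 : ℂ)) +
      ((if k = -p.2 then (f 0 q * c) • fockAnn k (Finsupp.single n (1 : ℂ)) else 0) +
        (if k = p.2 then (f 0 q * c) • fockAnn k (Finsupp.single n (1 : ℂ)) else 0) +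
        (if k = 0 then (f q 0 * c) • (pairCre p.2 (Finsupp.single n (1 : ℂ))) else 0)) := by
    intro k
    by_cases h0 : k = 0
    · subst h0
      have e1 : (0 : Mode ν) ≠ p.2 := hp.symm
      have e2 : (0 : Mode ν) ≠ -p.2 := by simpa using hp
      simp [-Finsupp.smul_single, cre, ann, condensate, hp, e1, e2, momentum_zero, momentum_neg,
        hf₁, ← hq, ← hc', pairCre]
      module
    by_cases h1 : k = p.2
    · subst h1
      have e2 := (neg_ne_self_of_ne_zero hp).symm
      have e3 : p.2 + p.2 ≠ 0 := fun h => e2 (eq_neg_of_add_eq_zero_left h)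
      simp [cre, ann, condensate, hp, e2, e3, momentum_zero, ← hq, ← hc']
      module
    by_cases h2 : k = -p.2
    · subst h2
      have e2 := neg_ne_self_of_ne_zero hp
      have e3 : -p.2 - p.2 ≠ 0 := fun h => e2 (sub_eq_zero.1 h)
      simp [cre, ann, condensate, hp, e2, e3, momentum_zero, momentum_neg, hf₂, ← hq, ← hc']
      module
    have e1 : k + p.2 ≠ 0 := fun h => h2 (eq_neg_of_add_eq_zero_left h)
    have e2 : k - p.2 ≠ 0 := fun h => h1 (sub_eq_zero.1 h)
    simp [cre, ann, condensate, h0, h1, h2, e1, e2]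
  rw [LinearMap.add_apply, hopping_single, densityFluct, Finsupp.linearCombination_single, one_smul,
    Finset.sum_congr rfl fun k _ => term k]
  simp only [Finset.sum_add_distrib (s := insert 0 n.support), sum_ite, sum_zero]
  rw [smul_add, add_comm]
  congr 1
  simp only [linearFluct, pairAnn, LinearMap.smul_apply, LinearMap.add_apply, hf₃]
  have hcc : c * ((1 / (2 * √(ρ₀ * p.1 ^ ν)) : ℝ) : ℂ) = 1 / 2 := by
    push_cast
    rw [← hc']
    field_simp
  simp only [smul_add, smul_smul, mul_comm _ c, ← mul_assoc, hcc]
  abel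

theorem J_zero_left {f : TestFun ν} {q : Momentum ν} (hq : q ≠ 0) :
    J f.1 q 0 = -Complex.I * f.1 q 0 := by simp [J, hq]

theorem J_zero_right {f : TestFun ν} {q : Momentum ν} (hq : q ≠ 0) :
    J f.1 0 q = starRingEnd ℂ (J f.1 q 0) := by
  rw [J_zero_left hq, map_mul, f.2.2.2.2]
  simp [J, hq]

theorem orderFluct_J_eq (ρ₀ : ℝ) (f : TestFun ν) {p : BoxMode ν} (hp : p.2 ≠ 0)
    (hq : momentum p.1 p.2 ≠ 0) :
    orderFluct ρ₀ (J f.1) p = linearFluct (f.1 (momentum p.1 p.2) 0) p.2 := by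
  rw [orderFluct_eq ρ₀ hp (J_zero_right hq), J_zero_left hq, ← mul_assoc]
  simp

/-- The amplitude `f(q, 0) + i g(q, 0)`. -/
def ampAt (x : Test ν) (q : Momentum ν) : ℂ := x.1.1 q 0 + Complex.I * x.2.1 q 0

theorem fluct_eq {ρ₀ : ℝ} (hρ₀ : 0 < ρ₀) (x : Test ν) {p : BoxMode ν} (hL : 0 < p.1)
    (hp : p.2 ≠ 0) :
    fluct ρ₀ x p = linearFluct (ampAt x (momentum p.1 p.2)) p.2 + hopping ρ₀ x.1.1 p := by
  rw [fluct, densityFluct_eq hρ₀ x.1 hL hp, orderFluct_eq ρ₀ hp (x.2.2.2.2.2 _ _).symm, ampAt,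
    linearFluct_add]
  abel

/-! ## Norm bounds -/

theorem norm_toFock_single (n : Mode ν →₀ ℕ) :
    ‖toFock (Finsupp.single n (1 : ℂ))‖ = 1 := by
  classical
  rw [toFock, Finsupp.linearCombination_single, one_smul, lp.norm_single (by norm_num)]
  simp

theorem norm_toFock_single' (n : Mode ν →₀ ℕ) (c : ℂ) :
    ‖toFock (Finsupp.single n c)‖ = ‖c‖ := by
  rw [single_eq_smul, map_smul, norm_smul, norm_toFock_single, mul_one]

/-- `φ` is a combination of vectors `|n⟩` with `d` particles, all in the modes `m` and `-m`, and
the sum of the absolute values of its coefficients is at most `C`. -/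
def IsPairBounded (m : Mode ν) (d : ℕ) (C : ℝ) (φ : FinFock ν) : Prop :=
  ∀ (T : FinFock ν →ₗ[ℂ] Fock ν) (B : ℝ), (∀ n : Mode ν →₀ ℕ, n.support ⊆ {m, -m} →
    n.degree = d → ‖T (Finsupp.single n 1)‖ ≤ B) → ‖T φ‖ ≤ C * B

theorem isPairBounded_vacuum (m : Mode ν) : IsPairBounded m 0 1 (vacuum ν) := fun T B h => by
  rw [one_mul]
  exact h 0 (by simp) (by simp)

/-- Testing against all linear maps `T` makes this a substitution of `T ∘ b*_k` for `T`; no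
coefficient has to be tracked. The factor comes from `n_k + 1 ≤ d + 1`. -/
theorem IsPairBounded.fockCre {m k : Mode ν} (hk : k ∈ ({m, -m} : Finset (Mode ν))) {d : ℕ}
    {C : ℝ} {φ : FinFock ν} (h : IsPairBounded m d C φ) :
    IsPairBounded m (d + 1) (C * √(d + 1)) (fockCre k φ) := fun T B hT => by
  rw [mul_assoc]
  refine h (T ∘ₗ BoseFluctuation.fockCre k) _ fun n hn hd => ?_
  rw [LinearMap.comp_apply, fockCre_single, single_eq_smul, map_smul, norm_smul,
    Complex.norm_real, Real.norm_of_nonneg (Real.sqrt_nonneg _)]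
  have hle : n k ≤ d := hd ▸ Finsupp.le_degree k n
  refine mul_le_mul (Real.sqrt_le_sqrt (by exact_mod_cast Nat.succ_le_succ hle)) (hT _ ?_ ?_)
    (norm_nonneg _) (Real.sqrt_nonneg _)
  · refine Finsupp.support_add.trans (Finset.union_subset hn ?_)
    exact Finsupp.support_single_subset.trans (Finset.singleton_subset_iff.2 hk)
  · simp [hd]

theorem isPairBounded_pairVec (m : Mode ν) (n : ℕ) :
    IsPairBounded m n (2 ^ n * √(n.factorial)) (pairVec m n) := by
  induction n with
  | zero => simpa [pairVec_zero] using isPairBounded_vacuum m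
  | succ n ih =>
    intro T B hT
    rw [pairVec_succ, pairCre, LinearMap.add_apply, map_add]
    refine (norm_add_le _ _).trans ((add_le_add (ih.fockCre (by simp) T B hT)
      (ih.fockCre (by simp) T B hT)).trans_eq ?_)
    rw [Nat.factorial_succ, Nat.cast_mul, Real.sqrt_mul (by positivity)]
    push_cast
    ring

theorem norm_toFock_pairVec_le (m : Mode ν) (n : ℕ) :
    ‖toFock (pairVec m n)‖ ≤ 2 ^ n * √(n.factorial) := by
  simpa using isPairBounded_pairVec m n toFock 1 fun k _ _ => (norm_toFock_single k).le

theorem norm_fockCre_fockAnn_le (k l : Mode ν) (n : Mode ν →₀ ℕ) :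
    ‖toFock (fockCre l (fockAnn k (Finsupp.single n 1)))‖ ≤ n.degree + 1 := by
  rw [fockAnn_single, single_eq_smul, map_smul, fockCre_single, map_smul, norm_smul,
    norm_toFock_single', Complex.norm_real, Complex.norm_real,
    Real.norm_of_nonneg (Real.sqrt_nonneg _), Real.norm_of_nonneg (Real.sqrt_nonneg _)]
  have h1 : n k ≤ n.degree := Finsupp.le_degree k n
  have h2 : (n - Finsupp.single k 1 : Mode ν →₀ ℕ) l ≤ n.degree :=
    (Nat.sub_le _ _).trans (Finsupp.le_degree l n)
  have h1' : (n k : ℝ) ≤ n.degree + 1 := by exact_mod_cast h1.trans (Nat.le_succ _)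
  have h2' : ((n - Finsupp.single k 1 : Mode ν →₀ ℕ) l : ℝ) + 1 ≤ n.degree + 1 := by
    exact_mod_cast Nat.succ_le_succ h2
  calc _ ≤ √(n.degree + 1 : ℝ) * √(n.degree + 1 : ℝ) := by gcongr
    _ = _ := Real.mul_self_sqrt (by positivity)

/-- Only `k ∈ {0, m, -m}` can contribute, whence the factor `3`. Evenness of `f` reduces the kernel
values to `f(2q,q)` and `f(0,q)`. Apart from these values and the volume prefactor, the bound
depends on `n` alone. -/
theorem norm_hopping_pairVec_le (ρ₀ : ℝ) (f : TestFun ν) {p : BoxMode ν} (hp : p.2 ≠ 0) (n : ℕ) :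
    ‖toFock (hopping ρ₀ f.1 p (pairVec p.2 n))‖ ≤ (2 ^ n * √(n.factorial)) *
      ((1 / (2 * √(ρ₀ * p.1 ^ ν))) * (3 * ((‖f.1 (momentum p.1 p.2 + momentum p.1 p.2)
        (momentum p.1 p.2)‖ + ‖f.1 0 (momentum p.1 p.2)‖) * (n + 1)))) := by
  obtain ⟨f, -, hf₁, hf₂, hf₃⟩ := f
  refine isPairBounded_pairVec p.2 n (toFock ∘ₗ hopping ρ₀ f p) _ fun N hN hd => ?_
  rw [LinearMap.comp_apply, hopping_single, map_smul, norm_smul, Complex.norm_real,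
    Real.norm_of_nonneg (by positivity), map_sum]
  refine mul_le_mul_of_nonneg_left ?_ (by positivity)
  set q := momentum p.1 p.2 with hq
  have key : ∀ a b : ℂ, ∀ k l l' : Mode ν,
      ‖toFock ((a • (fockCre l * fockAnn k) + b • (fockCre l' * fockAnn k))
        (Finsupp.single N 1))‖ ≤ (‖a‖ + ‖b‖) * (n + 1) := fun a b k l l' => by
    rw [LinearMap.add_apply, map_add, LinearMap.smul_apply, LinearMap.smul_apply, map_smul,
      map_smul, add_mul, ← hd]
    refine (norm_add_le _ _).trans ?_
    rw [norm_smul, norm_smul]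
    gcongr <;> exact norm_fockCre_fockAnn_le _ _ _
  have hsub : insert 0 N.support ⊆ ({0, p.2, -p.2} : Finset (Mode ν)) :=
    Finset.insert_subset_insert 0 hN
  refine (norm_sum_le_of_le _ (n := fun _ => (‖f (q + q) q‖ + ‖f 0 q‖) * (n + 1)) ?_).trans ?_
  · intro k hk
    have hk' := hsub hk
    simp only [Finset.mem_insert, Finset.mem_singleton] at hk'
    rcases hk' with rfl | rfl | rfl
    · have h0 : N 0 = 0 := by
        by_contra h
        have := hN (Finsupp.mem_support_iff.2 h)
        simp only [Finset.mem_insert, Finset.mem_singleton] at this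
        rcases this with h | h
        · exact hp h.symm
        · exact hp (neg_eq_zero.1 h.symm)
      have : ∀ l : Mode ν, (fockCre l * fockAnn 0 : Module.End ℂ (FinFock ν))
          (Finsupp.single N (1 : ℂ)) = 0 := fun l => by
        rw [Module.End.mul_apply, fockAnn_single_of_eq_zero h0, map_zero]
      rw [LinearMap.add_apply, LinearMap.smul_apply, LinearMap.smul_apply, this, this]
      simp only [smul_zero, add_zero, map_zero, norm_zero]
      positivity
    · refine (key _ _ _ _ _).trans_eq ?_
      rw [sub_self, momentum_zero, momentum_add]
    · refine (key _ _ _ _ _).trans_eq ?_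
      rw [neg_add_cancel, momentum_zero, sub_eq_add_neg, momentum_add, momentum_neg, ← neg_add,
        hf₁, hf₂, hf₂, add_comm ‖f 0 _‖]
  · rw [Finset.sum_const, nsmul_eq_mul]
    refine mul_le_mul_of_nonneg_right ?_ (by positivity)
    exact_mod_cast (Finset.card_le_card hsub).trans Finset.card_le_three

/-! ## The thermodynamic limit -/

theorem tendsto_size (q : Momentum ν) : Tendsto (fun p : BoxMode ν => p.1) (thermo q) atTop :=
  (tendsto_fst (g := 𝓝 q)).comp (tendsto_comap (f := fun p : BoxMode ν => (p.1, momentum p.1 p.2)))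

theorem tendsto_momentum (q : Momentum ν) :
    Tendsto (fun p : BoxMode ν => momentum p.1 p.2) (thermo q) (𝓝 q) :=
  (tendsto_snd (f := atTop)).comp
    (tendsto_comap (f := fun p : BoxMode ν => (p.1, momentum p.1 p.2)))

theorem eventually_momentum_ne {q : Momentum ν} (hq : q ≠ 0) :
    ∀ᶠ p in thermo q, momentum p.1 p.2 ≠ 0 :=
  (tendsto_momentum q).eventually_ne hq

theorem eventually_mode_ne {q : Momentum ν} (hq : q ≠ 0) : ∀ᶠ p in thermo q, p.2 ≠ 0 :=
  (eventually_momentum_ne hq).mono fun p hp h => hp (by rw [h, momentum_zero])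

theorem eventually_size_pos (q : Momentum ν) : ∀ᶠ p in thermo q, 0 < p.1 :=
  (tendsto_size q).eventually_gt_atTop 0

/-- Rounding `L q_i / 2π` down gives box momenta whose coordinates are within `2π / L` of those of
`q`. This makes the inner limits unique. -/
instance (q : Momentum ν) : (thermo q).NeBot := by
  let m : ℝ → Mode ν := fun L i => ⌊L / (2 * Real.pi) * q i⌋
  have hm : Tendsto (fun L => momentum L (m L)) atTop (𝓝 q) := by
    have h : Tendsto (fun L : ℝ => fun i => 2 * Real.pi / L * (m L i : ℝ)) atTop
        (𝓝 fun i => q i) := by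
      rw [tendsto_pi_nhds]
      intro i
      have h0 : Tendsto (fun L : ℝ => 2 * Real.pi / L) atTop (𝓝 0) :=
        tendsto_const_nhds.div_atTop tendsto_id
      refine tendsto_iff_norm_sub_tendsto_zero.2 (squeeze_zero_norm' ?_ h0)
      filter_upwards [eventually_gt_atTop 0] with L hL
      rw [norm_norm]
      have e : 2 * Real.pi / L * (m L i : ℝ) - q i =
          2 * Real.pi / L * ((m L i : ℝ) - L / (2 * Real.pi) * q i) := by
        have := Real.pi_pos
        field_simp
      rw [e, norm_mul, Real.norm_of_nonneg (by positivity)]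
      refine mul_le_of_le_one_right (by positivity) ?_
      rw [Real.norm_eq_abs, abs_sub_comm, abs_of_nonneg (sub_nonneg.2 (Int.floor_le _))]
      linarith [Int.lt_floor_add_one (L / (2 * Real.pi) * q i)]
    exact ((PiLp.continuous_toLp 2 _).tendsto _).comp h
  have : Tendsto (fun L => ((L, m L) : BoxMode ν)) atTop (thermo q) :=
    tendsto_comap_iff.2 (tendsto_id.prodMk hm)
  exact this.neBot

/-- On the vectors `(b^*_m + b^*_{-m})^n Ω` the operators `X` are asymptotically linear in the
creation and annihilation operators, with amplitudes `Z`. -/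
def IsAsympLinear (F : Filter (BoxMode ν)) (X : BoxMode ν → Module.End ℂ (FinFock ν))
    (Z : BoxMode ν → ℂ) : Prop :=
  ∀ n, Tendsto (fun p => ‖toFock (X p (pairVec p.2 n) - linearFluct (Z p) p.2 (pairVec p.2 n))‖)
    F (𝓝 0)

theorem tendsto_hopping {ρ₀ : ℝ} (hρ₀ : 0 < ρ₀) (hν : ν ≠ 0) (f : TestFun ν) {q : Momentum ν}
    (hq : q ≠ 0) (n : ℕ) :
    Tendsto (fun p => ‖toFock (hopping ρ₀ f.1 p (pairVec p.2 n))‖) (thermo q) (𝓝 0) := by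
  have hf : Continuous (Function.uncurry f.1) := f.2.1
  have h1 : Tendsto (fun p : BoxMode ν => 1 / (2 * √(ρ₀ * p.1 ^ ν))) (thermo q) (𝓝 0) := by
    refine tendsto_const_nhds.div_atTop (Tendsto.const_mul_atTop two_pos ?_)
    refine Real.tendsto_sqrt_atTop.comp (Tendsto.const_mul_atTop hρ₀ ?_)
    exact (tendsto_pow_atTop hν).comp (tendsto_size q)
  have hm := tendsto_momentum q
  have h2 : Tendsto (fun p : BoxMode ν => f.1 (momentum p.1 p.2 + momentum p.1 p.2)
      (momentum p.1 p.2)) (thermo q) (𝓝 (f.1 (q + q) q)) :=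
    (hf.tendsto (q + q, q)).comp ((hm.add hm).prodMk_nhds hm)
  have h3 : Tendsto (fun p : BoxMode ν => f.1 0 (momentum p.1 p.2)) (thermo q) (𝓝 (f.1 0 q)) :=
    (hf.tendsto (0, q)).comp (tendsto_const_nhds.prodMk_nhds hm)
  have h := (h1.mul (((h2.norm.add h3.norm).mul_const ((n : ℝ) + 1)).const_mul 3)).const_mul
    (2 ^ n * √(n.factorial : ℝ))
  rw [zero_mul, mul_zero] at h
  refine squeeze_zero' (Eventually.of_forall fun p => norm_nonneg _) ?_ h
  filter_upwards [eventually_mode_ne hq] with p hp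
  exact norm_hopping_pairVec_le ρ₀ f hp n

theorem isAsympLinear_fluct {ρ₀ : ℝ} (hρ₀ : 0 < ρ₀) (hν : ν ≠ 0) (x : Test ν) {q : Momentum ν}
    (hq : q ≠ 0) :
    IsAsympLinear (thermo q) (fluct ρ₀ x) fun p => ampAt x (momentum p.1 p.2) := fun n => by
  refine (tendsto_hopping hρ₀ hν x.1 hq n).congr' ?_
  filter_upwards [eventually_mode_ne hq, eventually_size_pos q] with p hp hL
  rw [fluct_eq hρ₀ x hL hp, LinearMap.add_apply, add_sub_cancel_left]

theorem ampAt_left (f : TestFun ν) (q : Momentum ν) : ampAt (f, 0) q = f.1 q 0 := by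
  simp [ampAt]

theorem isAsympLinear_densityFluct {ρ₀ : ℝ} (hρ₀ : 0 < ρ₀) (hν : ν ≠ 0) (f : TestFun ν)
    {q : Momentum ν} (hq : q ≠ 0) :
    IsAsympLinear (thermo q) (densityFluct ρ₀ f.1) fun p => ampAt (f, 0) (momentum p.1 p.2) :=
  fun n => by
  refine (tendsto_hopping hρ₀ hν f hq n).congr' ?_
  filter_upwards [eventually_mode_ne hq, eventually_size_pos q] with p hp hL
  rw [densityFluct_eq hρ₀ f hL hp, ampAt_left, LinearMap.add_apply, add_sub_cancel_left]

theorem isAsympLinear_orderFluct_J (ρ₀ : ℝ) (f : TestFun ν) {q : Momentum ν} (hq : q ≠ 0) :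
    IsAsympLinear (thermo q) (orderFluct ρ₀ (J f.1)) fun p => ampAt (f, 0) (momentum p.1 p.2) :=
  fun n => by
  refine tendsto_const_nhds.congr' ?_
  filter_upwards [eventually_mode_ne hq, eventually_momentum_ne hq] with p hp hp'
  rw [orderFluct_J_eq ρ₀ f hp hp', ampAt_left, sub_self, map_zero, norm_zero]

/-! ## Comparison of unitary groups with explicit paths of vectors -/

theorem IsExp.norm_map {X : Module.End ℂ (FinFock ν)} {U : ℝ → Fock ν →L[ℂ] Fock ν}
    (hU : IsExp X U) (t : ℝ) (ψ : Fock ν) : ‖U t ψ‖ = ‖ψ‖ :=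
  ContinuousLinearMap.norm_map_of_mem_unitary (hU.mem_unitary t) ψ

/-- The group law makes `U 0` idempotent, and an idempotent unitary is the identity. -/
theorem IsExp.zero {X : Module.End ℂ (FinFock ν)} {U : ℝ → Fock ν →L[ℂ] Fock ν}
    (hU : IsExp X U) : U 0 = 1 := by
  have h1 : star (U 0) * U 0 = 1 := Unitary.star_mul_self_of_mem (hU.mem_unitary 0)
  have h2 : U 0 = U 0 * U 0 := by simpa using hU.map_add 0 0
  calc U 0 = star (U 0) * U 0 * U 0 := by rw [h1, one_mul]
    _ = 1 := by rw [mul_assoc, ← h2, h1]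

theorem IsExp.apply_neg_apply {X : Module.End ℂ (FinFock ν)} {U : ℝ → Fock ν →L[ℂ] Fock ν}
    (hU : IsExp X U) (t : ℝ) (ψ : Fock ν) : U t (U (-t) ψ) = ψ := by
  rw [← mul_apply_eq_comp, ← hU.map_add, add_neg_cancel, hU.zero]
  rfl

theorem IsExp.hasDerivAt {X : Module.End ℂ (FinFock ν)} {U : ℝ → Fock ν →L[ℂ] Fock ν}
    (hU : IsExp X U) (φ : FinFock ν) (t : ℝ) :
    HasDerivAt (fun s => U s (toFock φ)) (U t (Complex.I • toFock (X φ))) t := by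
  have h0 : HasDerivAt (fun s => U (s - t) (toFock φ)) (Complex.I • toFock (X φ)) t :=
    HasDerivAt.comp_sub_const (f := fun s => U s (toFock φ)) t t
      (by simpa using hU.generator φ)
  have h1 := ((U t).restrictScalars ℝ).hasFDerivAt.comp_hasDerivAt t h0
  refine h1.congr_of_eventuallyEq (Eventually.of_forall fun s => ?_)
  change U s (toFock φ) = U t (U (s - t) (toFock φ))
  rw [← mul_apply_eq_comp, ← hU.map_add, add_sub_cancel]

theorem IsExp.hasDerivAt_neg {X : Module.End ℂ (FinFock ν)} {U : ℝ → Fock ν →L[ℂ] Fock ν}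
    (hU : IsExp X U) (φ : FinFock ν) (t : ℝ) :
    HasDerivAt (fun s => U (-s) (toFock φ)) (-U (-t) (Complex.I • toFock (X φ))) t := by
  have h := (hU.hasDerivAt φ (-t)).scomp t (_root_.hasDerivAt_neg t)
  exact h.congr_deriv (neg_one_smul ℝ _)

/-- A path of finite vectors that solves `φ' = i X φ` up to an error `δ` stays close to the orbit
of the unitary group. -/
theorem IsExp.norm_path_sub_le {X : Module.End ℂ (FinFock ν)} {U : ℝ → Fock ν →L[ℂ] Fock ν}
    (hU : IsExp X U) (S : Finset ℕ) (v : ℕ → FinFock ν) {c c' : ℕ → ℝ → ℂ}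
    (hc : ∀ n s, HasDerivAt (c n) (c' n s) s) {t δ : ℝ}
    (hδ : ∀ s ∈ Set.uIcc 0 t, ‖toFock (∑ n ∈ S, c' n s • v n -
      Complex.I • X (∑ n ∈ S, c n s • v n))‖ ≤ δ) :
    ‖toFock (∑ n ∈ S, c n t • v n) - U t (toFock (∑ n ∈ S, c n 0 • v n))‖ ≤ δ * |t| := by
  -- Interaction picture: pulling the path back by the group leaves only the defect in the
  -- derivative. As `U (-s)` is isometric, the mean value inequality applies. Only the generator on
  -- finite vectors is used, so the choice of extension does not matter.
  set G : ℝ → Fock ν := fun s => ∑ n ∈ S, c n s • U (-s) (toFock (v n)) with hG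
  have hG_eq : ∀ s, G s = U (-s) (toFock (∑ n ∈ S, c n s • v n)) := fun s => by
    simp only [hG, map_sum, map_smul]
  have hd : ∀ s, HasDerivAt G (U (-s) (toFock (∑ n ∈ S, c' n s • v n -
      Complex.I • X (∑ n ∈ S, c n s • v n)))) s := fun s => by
    refine (HasDerivAt.fun_sum fun n _ =>
      (hc n s).smul (hU.hasDerivAt_neg (v n) s)).congr_deriv ?_
    simp only [map_sub, map_sum, map_smul, Finset.smul_sum, ← Finset.sum_sub_distrib]
    refine Finset.sum_congr rfl fun n _ => ?_
    rw [smul_neg, smul_comm Complex.I]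
    abel
  have h := Convex.norm_image_sub_le_of_norm_hasDerivWithin_le
    (fun s _ => (hd s).hasDerivWithinAt)
    (fun s hs => (hU.norm_map (-s) _).trans_le (hδ s hs)) (convex_uIcc 0 t)
    Set.left_mem_uIcc Set.right_mem_uIcc
  rw [sub_zero, Real.norm_eq_abs, hG_eq, hG_eq, ← hU.norm_map t, map_sub, hU.apply_neg_apply,
    neg_zero, hU.zero] at h
  exact h

/-! ## Truncated coherent vectors -/

/-- The coherent vector `a exp(w (b^*_m + b^*_{-m})) Ω`, truncated at `N` particles. -/
def cohVec (m : Mode ν) (N : ℕ) (a w : ℂ) : FinFock ν :=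
  ∑ n ∈ Finset.range (N + 1), (a * (w ^ n / n.factorial)) • pairVec m n

theorem linearFluct_pairVec_zero (z : ℂ) (m : Mode ν) :
    linearFluct z m (pairVec m 0) = (z / 2) • pairVec m 1 := by
  rw [linearFluct, LinearMap.smul_apply, LinearMap.add_apply, LinearMap.smul_apply,
    LinearMap.smul_apply, ← pairVec_succ, pairVec_zero, pairAnn_vacuum]
  module

theorem linearFluct_pairVec_succ (z : ℂ) {m : Mode ν} (hm : m ≠ 0) (n : ℕ) :
    linearFluct z m (pairVec m (n + 1)) =
      (z / 2) • pairVec m (n + 2) + (starRingEnd ℂ z * (n + 1)) • pairVec m n := by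
  rw [linearFluct, LinearMap.smul_apply, LinearMap.add_apply, LinearMap.smul_apply,
    LinearMap.smul_apply, ← pairVec_succ, pairAnn_pairVec_succ hm]
  module

/-- The truncated coherent vectors solve the linear equation of motion up to boundary terms. -/
theorem cohVec_defect (z a w : ℂ) {m : Mode ν} (hm : m ≠ 0) (N : ℕ) :
    ∑ n ∈ Finset.range (N + 1), (a * (Complex.I * starRingEnd ℂ z * w * (w ^ n / n.factorial) +
        Complex.I * z / 2 * (n * w ^ (n - 1) / n.factorial))) • pairVec m n -
      Complex.I • linearFluct z m (cohVec m N a w) =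
    (Complex.I * starRingEnd ℂ z * w * (a * (w ^ N / N.factorial))) • pairVec m N -
      (Complex.I * z / 2 * (a * (w ^ N / N.factorial))) • pairVec m (N + 1) := by
  unfold cohVec
  induction N with
  | zero =>
    simp only [zero_add, Finset.sum_range_one, map_smul, linearFluct_pairVec_zero]
    simp
    module
  | succ N ih =>
    rw [Finset.sum_range_succ, Finset.sum_range_succ _ (N + 1), map_add, smul_add, add_sub_add_comm,
      ih, map_smul, linearFluct_pairVec_succ z hm]
    have h1 : ((N + 1 : ℕ) : ℂ) * w ^ (N + 1 - 1) / (N + 1).factorial = w ^ N / N.factorial := by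
      rw [Nat.factorial_succ, Nat.add_sub_cancel, Nat.cast_mul]
      have : ((N + 1 : ℕ) : ℂ) ≠ 0 := Nat.cast_ne_zero.2 N.succ_ne_zero
      field_simp
    have h2 : w ^ (N + 1) / (N + 1).factorial * ((N : ℂ) + 1) = w * (w ^ N / N.factorial) := by
      rw [Nat.factorial_succ, Nat.cast_mul]
      have : ((N + 1 : ℕ) : ℂ) ≠ 0 := Nat.cast_ne_zero.2 N.succ_ne_zero
      push_cast at this ⊢
      field_simp
      ring
    rw [h1]
    set A := w ^ (N + 1) / (N + 1).factorial
    set B := w ^ N / N.factorial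
    have h3 : a * A * (starRingEnd ℂ z * ((N : ℂ) + 1)) = a * starRingEnd ℂ z * (w * B) := by
      rw [← h2]; ring
    rw [smul_add, smul_smul (a * A), smul_smul (a * A), h3]
    module

/-- The curve solves `w' = i z / 2` and `a' = i conj z · w · a`. The coefficient in the second
equation is `½ conj z` times the commutator `2`; integrating it along the linear `w` produces the
quadratic term in the exponent. -/
theorem hasDerivAt_cohCoeff (a₀ w₀ z : ℂ) (n : ℕ) (s : ℝ) :
    HasDerivAt (fun s : ℝ => a₀ * Complex.exp (Complex.I * starRingEnd ℂ z * w₀ * s -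
        z * starRingEnd ℂ z * s ^ 2 / 4) * ((w₀ + Complex.I * z / 2 * s) ^ n / n.factorial))
      (a₀ * Complex.exp (Complex.I * starRingEnd ℂ z * w₀ * s -
        z * starRingEnd ℂ z * s ^ 2 / 4) * (Complex.I * starRingEnd ℂ z *
          (w₀ + Complex.I * z / 2 * s) * ((w₀ + Complex.I * z / 2 * s) ^ n / n.factorial) +
        Complex.I * z / 2 * (n * (w₀ + Complex.I * z / 2 * s) ^ (n - 1) / n.factorial))) s := by
  have hs : HasDerivAt (fun s : ℝ => (s : ℂ)) 1 s := Complex.ofRealCLM.hasDerivAt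
  have hw : HasDerivAt (fun s : ℝ => w₀ + Complex.I * z / 2 * (s : ℂ)) (Complex.I * z / 2) s := by
    simpa using (hs.const_mul (Complex.I * z / 2)).const_add w₀
  have he := ((hs.const_mul (Complex.I * starRingEnd ℂ z * w₀)).sub
    (((hs.pow 2).const_mul (z * starRingEnd ℂ z)).div_const 4)).cexp.const_mul a₀
  refine (he.mul ((hw.pow n).div_const (n.factorial : ℂ))).congr_deriv ?_
  simp only [Pi.pow_apply, Pi.sub_apply]
  linear_combination (-(1 / 2) * a₀ * z * starRingEnd ℂ z * s *
    Complex.exp (Complex.I * starRingEnd ℂ z * w₀ * s - z * starRingEnd ℂ z * s ^ 2 / 4) *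
    ((w₀ + Complex.I * z / 2 * s) ^ n / n.factorial)) * Complex.I_sq

/-- The truncation error at particle number `N`. -/
def truncErr (B : ℝ) (N : ℕ) : ℝ :=
  (B ^ 3 + B ^ 2 * 2) * √((4 * B ^ 2 * 4) ^ N / N.factorial)

theorem tendsto_truncErr (B : ℝ) : Tendsto (truncErr B) atTop (𝓝 0) := by
  have h := (Real.continuous_sqrt.tendsto 0).comp
    (FloorSemiring.tendsto_pow_div_factorial_atTop (4 * B ^ 2 * 4))
  have h' := h.const_mul (B ^ 3 + B ^ 2 * 2)
  rw [Real.sqrt_zero, mul_zero] at h'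
  exact h'

/-- The coefficients decay like `1 / N!` while the vectors grow only like `√N!`, leaving `1 / √N!`.
The second factor `4` under the root absorbs `N + 1 ≤ 4 ^ N`. -/
theorem pow_div_factorial_mul_le (B : ℝ) (N : ℕ) :
    B ^ N / N.factorial * (2 ^ N * √(N.factorial)) * √(N + 1) ≤
      √((4 * B ^ 2 * 4) ^ N / N.factorial) := by
  have hf : (0 : ℝ) < N.factorial := by exact_mod_cast N.factorial_pos
  refine Real.le_sqrt_of_sq_le ?_
  have h1 : ((N : ℝ) + 1) ≤ 4 ^ N := by
    have : N + 1 ≤ 4 ^ N := Nat.lt_pow_self (by norm_num)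
    exact_mod_cast this
  calc (B ^ N / N.factorial * (2 ^ N * √(N.factorial)) * √(N + 1)) ^ 2
      = (B ^ N) ^ 2 / N.factorial ^ 2 * ((2 ^ N) ^ 2 * N.factorial) * (N + 1) := by
        rw [mul_pow, mul_pow, mul_pow, div_pow, Real.sq_sqrt hf.le, Real.sq_sqrt (by positivity)]
    _ ≤ (B ^ N) ^ 2 / N.factorial ^ 2 * ((2 ^ N) ^ 2 * N.factorial) * 4 ^ N := by gcongr
    _ = _ := by
        rw [← pow_mul, ← pow_mul, mul_pow, mul_pow, ← pow_mul,
          show (4 : ℝ) ^ N = 2 ^ (N * 2) by rw [mul_comm, pow_mul]; norm_num, mul_comm 2 N]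
        field_simp

theorem norm_boundary_le {B : ℝ} {z a w : ℂ} (hz : ‖z‖ ≤ B) (ha : ‖a‖ ≤ B) (hw : ‖w‖ ≤ B)
    (m : Mode ν) (N : ℕ) :
    ‖toFock ((Complex.I * starRingEnd ℂ z * w * (a * (w ^ N / N.factorial))) • pairVec m N -
      (Complex.I * z / 2 * (a * (w ^ N / N.factorial))) • pairVec m (N + 1))‖ ≤ truncErr B N := by
  have hB : 0 ≤ B := (norm_nonneg _).trans hz
  have key := pow_div_factorial_mul_le B N
  have hone : (1 : ℝ) ≤ √(N + 1) :=
    Real.one_le_sqrt.2 (le_add_of_nonneg_left (Nat.cast_nonneg N))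
  have h1 : ‖toFock (pairVec m N)‖ ≤ 2 ^ N * √(N.factorial) * √(N + 1) :=
    (norm_toFock_pairVec_le m N).trans (le_mul_of_one_le_right (by positivity) hone)
  have h2 : ‖toFock (pairVec m (N + 1))‖ ≤ 2 * (2 ^ N * √(N.factorial) * √(N + 1)) := by
    refine (norm_toFock_pairVec_le m (N + 1)).trans_eq ?_
    rw [Nat.factorial_succ, Nat.cast_mul, Real.sqrt_mul (by positivity)]
    push_cast
    ring
  rw [map_sub, map_smul, map_smul]
  refine (norm_sub_le _ _).trans ?_
  rw [norm_smul, norm_smul]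
  simp only [norm_mul, norm_div, norm_pow, Complex.norm_I, RCLike.norm_conj, Complex.norm_natCast,
    Complex.norm_ofNat, one_mul]
  calc ‖z‖ * ‖w‖ * (‖a‖ * (‖w‖ ^ N / N.factorial)) * ‖toFock (pairVec m N)‖ +
        ‖z‖ / 2 * (‖a‖ * (‖w‖ ^ N / N.factorial)) * ‖toFock (pairVec m (N + 1))‖
      ≤ B * B * (B * (B ^ N / N.factorial)) * (2 ^ N * √(N.factorial) * √(N + 1)) +
        B / 2 * (B * (B ^ N / N.factorial)) * (2 * (2 ^ N * √(N.factorial) * √(N + 1))) := by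
        gcongr
    _ = (B ^ 3 + B ^ 2) * (B ^ N / N.factorial * (2 ^ N * √(N.factorial)) * √(N + 1)) := by ring
    _ ≤ (B ^ 3 + B ^ 2 * 2) * √((4 * B ^ 2 * 4) ^ N / N.factorial) := by
        gcongr
        linarith [sq_nonneg B]

theorem norm_cohVec_remainder_le (X : Module.End ℂ (FinFock ν)) {B : ℝ} {z a w : ℂ}
    (ha : ‖a‖ ≤ B) (hw : ‖w‖ ≤ B) (m : Mode ν) (N : ℕ) :
    ‖toFock (X (cohVec m N a w) - linearFluct z m (cohVec m N a w))‖ ≤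
      ∑ n ∈ Finset.range (N + 1), B * (B ^ n / n.factorial) *
        ‖toFock (X (pairVec m n) - linearFluct z m (pairVec m n))‖ := by
  have hB : 0 ≤ B := (norm_nonneg _).trans ha
  have e : X (cohVec m N a w) - linearFluct z m (cohVec m N a w) =
      ∑ n ∈ Finset.range (N + 1), (a * (w ^ n / n.factorial)) •
        (X (pairVec m n) - linearFluct z m (pairVec m n)) := by
    simp only [cohVec, map_sum, map_smul, smul_sub, Finset.sum_sub_distrib]
  rw [e, map_sum]
  refine norm_sum_le_of_le _ fun n _ => ?_
  rw [map_smul, norm_smul, norm_mul, norm_div, norm_pow, Complex.norm_natCast]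
  gcongr

/-- The evolution of a truncated coherent vector. -/
theorem IsExp.norm_cohVec_sub_le {X : Module.End ℂ (FinFock ν)} {U : ℝ → Fock ν →L[ℂ] Fock ν}
    (hU : IsExp X U) {m : Mode ν} (hm : m ≠ 0) {B : ℝ} {z a w : ℂ} {t : ℝ} (hz : ‖z‖ ≤ B)
    (ha : ‖a‖ * Real.exp (‖z‖ * ‖w‖ * |t|) ≤ B) (hw : ‖w‖ + ‖z‖ * |t| ≤ B) (N : ℕ) :
    ‖toFock (cohVec m N (a * Complex.exp (Complex.I * starRingEnd ℂ z * w * t -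
        z * starRingEnd ℂ z * t ^ 2 / 4)) (w + Complex.I * z / 2 * t)) -
      U t (toFock (cohVec m N a w))‖ ≤ (truncErr B N + ∑ n ∈ Finset.range (N + 1),
        B * (B ^ n / n.factorial) *
          ‖toFock (X (pairVec m n) - linearFluct z m (pairVec m n))‖) * |t| := by
  have h := hU.norm_path_sub_le (Finset.range (N + 1)) (pairVec m)
    (fun n s => hasDerivAt_cohCoeff a w z n s) (t := t)
    (δ := truncErr B N + ∑ n ∈ Finset.range (N + 1),
        B * (B ^ n / n.factorial) *
          ‖toFock (X (pairVec m n) - linearFluct z m (pairVec m n))‖) ?_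
  · simpa [cohVec] using h
  intro s hs
  have hst : |s| ≤ |t| := by
    simpa using Set.abs_sub_left_of_mem_uIcc hs
  set a' := a * Complex.exp (Complex.I * starRingEnd ℂ z * w * s -
        z * starRingEnd ℂ z * s ^ 2 / 4) with ha'
  set w' := w + Complex.I * z / 2 * s with hw'
  have hwB : ‖w'‖ ≤ B := by
    refine (norm_add_le _ _).trans (le_trans ?_ hw)
    simp only [norm_mul, norm_div, Complex.norm_I, one_mul, Complex.norm_ofNat, Complex.norm_real,
      Real.norm_eq_abs]
    gcongr
    linarith [norm_nonneg z]
  have haB : ‖a'‖ ≤ B := by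
    refine le_trans ?_ ha
    rw [ha', norm_mul, Complex.norm_exp]
    gcongr
    -- The quadratic term only damps the amplitude and is dropped, so the bound `B` holds along the
    -- whole path.
    have e1 : (z * starRingEnd ℂ z * (s : ℂ) ^ 2 / 4).re = Complex.normSq z * s ^ 2 / 4 := by
      rw [Complex.mul_conj, ← Complex.ofReal_pow, ← Complex.ofReal_mul]
      exact_mod_cast Complex.ofReal_re (Complex.normSq z * s ^ (2 : ℕ) / 4)
    have e2 : (Complex.I * starRingEnd ℂ z * w * s).re ≤ ‖z‖ * ‖w‖ * |s| := by
      refine (Complex.re_le_norm _).trans_eq ?_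
      simp
    rw [Complex.sub_re, e1]
    have : 0 ≤ Complex.normSq z * s ^ 2 / 4 := by
      have := Complex.normSq_nonneg z
      positivity
    have : ‖z‖ * ‖w‖ * |s| ≤ ‖z‖ * ‖w‖ * |t| := by gcongr
    linarith
  have e : (∑ n ∈ Finset.range (N + 1), (a' * (Complex.I * starRingEnd ℂ z * w' *
        (w' ^ n / n.factorial) + Complex.I * z / 2 * (n * w' ^ (n - 1) / n.factorial))) •
          pairVec m n) - Complex.I • X (cohVec m N a' w') =
      ((Complex.I * starRingEnd ℂ z * w' * (a' * (w' ^ N / N.factorial))) • pairVec m N -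
        (Complex.I * z / 2 * (a' * (w' ^ N / N.factorial))) • pairVec m (N + 1)) -
      Complex.I • (X (cohVec m N a' w') - linearFluct z m (cohVec m N a' w')) := by
    rw [← cohVec_defect z a' w' hm N, smul_sub]
    abel
  change ‖toFock (_ - Complex.I • X (cohVec m N a' w'))‖ ≤ _
  rw [e, map_sub]
  refine (norm_sub_le _ _).trans (add_le_add (norm_boundary_le hz haB hwB m N) ?_)
  rw [map_smul, norm_smul, Complex.norm_I, one_mul]
  exact norm_cohVec_remainder_le X haB hwB m N

/-! ## Words of exponentials -/

/-- The parameters of the coherent vector obtained by applying a word of exponentials of linear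
terms to the vacuum; its first component is the vacuum expectation. -/
def cohParam : List (ℂ × ℝ) → ℂ × ℂ
  | [] => (1, 0)
  | (z, t) :: l =>
    ((cohParam l).1 * Complex.exp (Complex.I * starRingEnd ℂ z * (cohParam l).2 * t -
        z * starRingEnd ℂ z * t ^ 2 / 4), (cohParam l).2 + Complex.I * z / 2 * t)

theorem tendsto_cohParam {α ι : Type*} {F : Filter α} {Z : ι → α → ℂ} {z : ι → ℂ} (t : ι → ℝ)
    (hZ : ∀ j, Tendsto (Z j) F (𝓝 (z j))) (l : List ι) :
    Tendsto (fun p => cohParam (l.map fun j => (Z j p, t j))) F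
      (𝓝 (cohParam (l.map fun j => (z j, t j)))) := by
  induction l with
  | nil => exact tendsto_const_nhds
  | cons j l ih =>
    simp only [List.map_cons, cohParam]
    have h1 := (continuous_fst.tendsto _).comp ih
    have h2 := (continuous_snd.tendsto _).comp ih
    have hc := (Complex.continuous_conj.tendsto _).comp (hZ j)
    refine Tendsto.prodMk_nhds (h1.mul ((Complex.continuous_exp.tendsto _).comp ?_)) ?_
    · exact (((hc.const_mul _).mul h2).mul_const _).sub
        ((((hZ j).mul hc).mul_const _).div_const _)
    · exact h2.add ((((hZ j).const_mul _).div_const _).mul_const _)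

/-- The order of quantifiers is essential: `N` is fixed before the box grows, because the hopping
error is controlled only for finitely many particle numbers at a time. -/
theorem eventually_norm_word_sub_le {F : Filter (BoxMode ν)} (hF : ∀ᶠ p in F, p.2 ≠ 0)
    {ι : Type*} {X : ι → BoxMode ν → Module.End ℂ (FinFock ν)} {Z : ι → BoxMode ν → ℂ}
    {z : ι → ℂ} (t : ι → ℝ) {U : ι → BoxMode ν → ℝ → Fock ν →L[ℂ] Fock ν}
    (hU : ∀ j, ∀ᶠ p in F, IsExp (X j p) (U j p)) (hX : ∀ j, IsAsympLinear F (X j) (Z j))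
    (hZ : ∀ j, Tendsto (Z j) F (𝓝 (z j))) (l : List ι) :
    ∀ ε > 0, ∀ᶠ N in atTop, ∀ᶠ p in F,
      ‖toFock (cohVec p.2 N (cohParam (l.map fun j => (Z j p, t j))).1
          (cohParam (l.map fun j => (Z j p, t j))).2) -
        (l.map fun j => U j p (t j)).prod (toFock (vacuum ν))‖ ≤ ε := by
  induction l with
  | nil =>
    intro ε hε
    refine Eventually.of_forall fun N => Eventually.of_forall fun p => ?_
    have : cohVec p.2 N 1 0 = vacuum ν := by
      rw [cohVec, Finset.sum_range_succ', Finset.sum_eq_zero]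
      · simp [pairVec_zero]
      · intro n _; simp
    simp only [List.map_nil, cohParam, List.prod_nil, this]
    simpa using hε.le
  | cons j l ih =>
    intro ε hε
    have hP := tendsto_cohParam t hZ l
    have h1 := ((continuous_fst.tendsto _).comp hP).norm
    have h2 := ((continuous_snd.tendsto _).comp hP).norm
    have h3 := (hZ j).norm
    have h4 := h1.mul ((Real.continuous_exp.tendsto _).comp ((h3.mul h2).mul_const |t j|))
    have h5 := h2.add (h3.mul_const |t j|)
    -- The parameters converge along `F`, so one bound serves eventually for all boxes,
    -- independently of `N`.
    obtain ⟨B, hB⟩ : ∃ B, ∀ᶠ p in F, ‖Z j p‖ ≤ B ∧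
        ‖(cohParam (l.map fun j => (Z j p, t j))).1‖ * Real.exp (‖Z j p‖ *
          ‖(cohParam (l.map fun j => (Z j p, t j))).2‖ * |t j|) ≤ B ∧
        ‖(cohParam (l.map fun j => (Z j p, t j))).2‖ + ‖Z j p‖ * |t j| ≤ B := by
      obtain ⟨B₁, hB₁⟩ := h3.isBoundedUnder_le
      obtain ⟨B₂, hB₂⟩ := h4.isBoundedUnder_le
      obtain ⟨B₃, hB₃⟩ := h5.isBoundedUnder_le
      refine ⟨max B₁ (max B₂ B₃), ?_⟩
      filter_upwards [eventually_map.1 hB₁, eventually_map.1 hB₂, eventually_map.1 hB₃]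
        with p q₁ q₂ q₃
      exact ⟨le_max_of_le_left q₁, le_max_of_le_right (le_max_of_le_left q₂),
        le_max_of_le_right (le_max_of_le_right q₃)⟩
    -- Truncation and hopping each get this share, so that after multiplication by `|t j|` they cost
    -- at most `ε / 2` together. The rest of the word uses the other half.
    have hδ : 0 < ε / (4 * (|t j| + 1)) := by positivity
    filter_upwards [ih (ε / 2) (half_pos hε),
      (tendsto_truncErr B).eventually_le_const hδ] with N hN hN'
    have hS : Tendsto (fun p => ∑ n ∈ Finset.range (N + 1), B * (B ^ n / n.factorial) *
        ‖toFock (X j p (pairVec p.2 n) - linearFluct (Z j p) p.2 (pairVec p.2 n))‖) F (𝓝 0) := by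
      simpa using tendsto_finsetSum (Finset.range (N + 1)) fun n _ =>
        (hX j n).const_mul (B * (B ^ n / (n.factorial : ℝ)))
    filter_upwards [hF, hU j, hN, hS.eventually_le_const hδ, hB] with p hm hUp hp hSp hBp
    obtain ⟨hB₁, hB₂, hB₃⟩ := hBp
    have key := hUp.norm_cohVec_sub_le hm hB₁ hB₂ hB₃ N
    simp only [List.map_cons, cohParam, List.prod_cons]
    have hrest := (hUp.norm_map (t j) _).trans_le hp
    rw [map_sub] at hrest
    refine (norm_sub_le_norm_sub_add_norm_sub _ _ _).trans ((add_le_add key hrest).trans ?_)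
    have hle : (ε / (4 * (|t j| + 1)) + ε / (4 * (|t j| + 1))) * |t j| ≤ ε / 2 := by
      have e : ε / (4 * (|t j| + 1)) + ε / (4 * (|t j| + 1)) = ε / 2 / (|t j| + 1) := by
        field_simp
        norm_num
      rw [e, div_mul_eq_mul_div]
      refine div_le_of_le_mul₀ (by positivity) (by positivity) ?_
      nlinarith [abs_nonneg (t j)]
    have hle' := mul_le_mul_of_nonneg_right (add_le_add hN' hSp) (abs_nonneg (t j))
    linarith

theorem inner_vacuum_toFock (φ : FinFock ν) :
    inner ℂ (toFock (vacuum ν)) (toFock φ) = φ 0 := by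
  classical
  induction φ using Finsupp.induction_linear with
  | zero => simp
  | add φ ψ h₁ h₂ => rw [map_add, inner_add_right, h₁, h₂, Finsupp.add_apply]
  | single n c =>
    rw [single_eq_smul, map_smul, inner_smul_right, vacuum]
    simp only [toFock, Finsupp.linearCombination_single, one_smul]
    rw [lp.inner_single_left]
    by_cases h : n = 0
    · subst h; simp
    · simp [lp.single_apply, Ne.symm h]

theorem pairVec_succ_apply_zero (m : Mode ν) (n : ℕ) : pairVec m (n + 1) 0 = 0 := by
  rw [pairVec_succ, pairCre, LinearMap.add_apply, Finsupp.add_apply, fockCre_apply_zero,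
    fockCre_apply_zero, add_zero]

theorem cohVec_apply_zero (m : Mode ν) (N : ℕ) (a w : ℂ) : cohVec m N a w 0 = a := by
  rw [cohVec, Finset.sum_range_succ', Finsupp.add_apply, Finsupp.finsetSum_apply,
    Finset.sum_eq_zero]
  · simp [pairVec_zero, vacuum]
  · intro n _
    rw [Finsupp.smul_apply, pairVec_succ_apply_zero, smul_zero]

/-- The vacuum expectation of a word of exponentials of asymptotically linear operators. -/
theorem tendsto_inner_word {F : Filter (BoxMode ν)} (hF : ∀ᶠ p in F, p.2 ≠ 0)
    {ι : Type*} {X : ι → BoxMode ν → Module.End ℂ (FinFock ν)} {Z : ι → BoxMode ν → ℂ}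
    {z : ι → ℂ} (t : ι → ℝ) {U : ι → BoxMode ν → ℝ → Fock ν →L[ℂ] Fock ν}
    (hU : ∀ j, ∀ᶠ p in F, IsExp (X j p) (U j p)) (hX : ∀ j, IsAsympLinear F (X j) (Z j))
    (hZ : ∀ j, Tendsto (Z j) F (𝓝 (z j))) (l : List ι) :
    Tendsto (fun p => inner ℂ (toFock (vacuum ν))
        ((l.map fun j => U j p (t j)).prod (toFock (vacuum ν)))) F
      (𝓝 (cohParam (l.map fun j => (z j, t j))).1) := by
  have h1 := (continuous_fst.tendsto _).comp (tendsto_cohParam t hZ l)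
  refine h1.congr_dist (Metric.tendsto_nhds.2 fun ε hε => ?_)
  obtain ⟨N, hN⟩ := (eventually_norm_word_sub_le hF t hU hX hZ l (ε / 2) (half_pos hε)).exists
  filter_upwards [hN] with p hp
  rw [dist_zero_right, Real.norm_of_nonneg dist_nonneg, dist_eq_norm]
  refine lt_of_le_of_lt ?_ (half_lt_self hε)
  set P := cohParam (l.map fun j => (Z j p, t j))
  -- The vacuum component of a truncated coherent vector is `a` for every `N`, so the expectation
  -- does not see the truncation.
  have e : P.1 = inner ℂ (toFock (vacuum ν)) (toFock (cohVec p.2 N P.1 P.2)) := by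
    rw [inner_vacuum_toFock, cohVec_apply_zero]
  change ‖P.1 - _‖ ≤ _
  rw [e, ← inner_sub_right]
  refine (norm_inner_le_norm _ _).trans ?_
  rwa [vacuum, norm_toFock_single, one_mul]

/-! ## The central limit theorem -/

theorem continuous_ampAt (x : Test ν) : Continuous (ampAt x) := by
  have h1 : Continuous (Function.uncurry x.1.1) := x.1.2.1
  have h2 : Continuous (Function.uncurry x.2.1) := x.2.2.1
  have hi : Continuous fun q : Momentum ν => (q, (0 : Momentum ν)) := by fun_prop
  exact (h1.comp hi).add ((h2.comp hi).const_smul Complex.I)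

theorem macroState_word {ι : Type*} (x : ι → Test ν) (t : ι → ℝ) (l : List ι) :
    macroState ν (l.map fun j => weyl (t j • x j)).prod =
      (cohParam (l.map fun j => (amplitude (x j), t j))).1 := by
  -- The second coherent parameter must be carried through the induction: it is `i/2` times the
  -- amplitude of the accumulated Weyl element, and it fixes the phase produced by the next factor.
  suffices h : ∃ (κ : ℂ) (y : Test ν), (l.map fun j => weyl (t j • x j)).prod = κ • weyl y ∧
      κ * Complex.exp (-(1 / 2) * (symForm y y : ℂ)) =
        (cohParam (l.map fun j => (amplitude (x j), t j))).1 ∧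
      Complex.I / 2 * amplitude y = (cohParam (l.map fun j => (amplitude (x j), t j))).2 by
    obtain ⟨κ, y, h1, h2, -⟩ := h
    rw [h1, map_smul, macroState_weyl, smul_eq_mul, h2]
  induction l with
  | nil => exact ⟨1, 0, by simp [CCR.one_def], by simp [symForm, form, cohParam],
      by simp [cohParam]⟩
  | cons j l ih =>
    obtain ⟨κ, y, h1, h2, h3⟩ := ih
    refine ⟨κ * CCR.phase (sympForm ν) (t j • x j) y, t j • x j + y, ?_, ?_, ?_⟩
    · rw [List.map_cons, List.prod_cons, h1, mul_smul_comm, CCR.W_mul_W, smul_smul]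
    · rw [List.map_cons, cohParam, ← h2, ← h3, CCR.phase, mul_assoc, mul_assoc, ← Complex.exp_add,
        ← Complex.exp_add]
      congr 2
      apply Complex.ext <;> simp [symForm, form, sympForm_apply, pow_two] <;> ring
    · rw [List.map_cons, cohParam, ← h3, map_add, map_smul, Complex.real_smul]
      ring

theorem isCLTLimit_of_isAsympLinear {ρ₀ : ℝ} (hρ₀ : 0 < ρ₀) (hν : ν ≠ 0)
    {X : BoxMode ν → Module.End ℂ (FinFock ν)} {x : Test ν}
    (hX : ∀ q, q ≠ 0 → IsAsympLinear (thermo q) X fun p => ampAt x (momentum p.1 p.2)) :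
    IsCLTLimit ρ₀ X x := by
  intro n y t U hU
  simp only [List.ofFn_eq_map]
  refine ⟨fun q => (cohParam ((List.finRange n).map
    fun j => (ampAt ((y j).getD x) q, t j))).1, fun q hq => ?_, ?_⟩
  · refine tendsto_inner_word (eventually_mode_ne hq) (X := fun j => (y j).elim X (fluct ρ₀))
      (Z := fun j p => ampAt ((y j).getD x) (momentum p.1 p.2)) t (fun j => ?_) (fun j => ?_)
      (fun j => ?_) _
    · filter_upwards [eventually_mode_ne hq, eventually_size_pos q] with p hp hL
      exact hU j p hL hp
    · cases h : y j with
      | none => exact hX q hq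
      | some w => exact isAsympLinear_fluct hρ₀ hν w hq
    · exact ((continuous_ampAt _).tendsto q).comp (tendsto_momentum q)
  · rw [macroState_word]
    refine (continuous_fst.tendsto _).comp (tendsto_cohParam t (fun j => ?_) _)
    exact ((continuous_ampAt _).tendsto 0).mono_left nhdsWithin_le_nhds

/-! ## Two-point functions -/

/-- The right factor creates one pair excitation with coefficient half its amplitude. Only the
annihilation part of the left factor returns to the vacuum. -/
theorem groundState_fluct_mul_fluct {ρ₀ : ℝ} (hρ₀ : 0 < ρ₀) (x y : Test ν) {p : BoxMode ν}
    (hL : 0 < p.1) (hp : p.2 ≠ 0) :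
    groundState (fluct ρ₀ x p * fluct ρ₀ y p) =
      1 / 2 * (starRingEnd ℂ (ampAt x (momentum p.1 p.2)) * ampAt y (momentum p.1 p.2)) := by
  rw [groundState, fluct_eq hρ₀ x hL hp, fluct_eq hρ₀ y hL hp, Module.End.mul_apply,
    LinearMap.add_apply _ (hopping ρ₀ y.1.1 p), hopping_vacuum, add_zero, ← pairVec_zero p.2,
    linearFluct_pairVec_zero, map_smul, LinearMap.add_apply, Finsupp.smul_apply, Finsupp.add_apply,
    hopping_apply_zero, add_zero, linearFluct_pairVec_succ _ hp, Finsupp.add_apply,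
    Finsupp.smul_apply, Finsupp.smul_apply, pairVec_succ_apply_zero, pairVec_zero, vacuum,
    Finsupp.single_eq_same]
  simp only [smul_eq_mul]
  push_cast
  ring

theorem iteratedLim_fluct_mul_fluct {ρ₀ : ℝ} (hρ₀ : 0 < ρ₀) (x y : Test ν) :
    IteratedLim (fun p => groundState (fluct ρ₀ x p * fluct ρ₀ y p)) (form x y) := by
  have hc : Continuous fun q => 1 / 2 * (starRingEnd ℂ (ampAt x q) * ampAt y q) :=
    continuous_const.mul ((Complex.continuous_conj.comp (continuous_ampAt x)).mul
      (continuous_ampAt y))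
  refine ⟨fun q => 1 / 2 * (starRingEnd ℂ (ampAt x q) * ampAt y q), fun q hq => ?_,
    (hc.tendsto 0).mono_left nhdsWithin_le_nhds⟩
  refine ((hc.tendsto q).comp (tendsto_momentum q)).congr' ?_
  filter_upwards [eventually_mode_ne hq, eventually_size_pos q] with p hp hL
  exact (groundState_fluct_mul_fluct hρ₀ x y hL hp).symm

theorem IteratedLim.unique (hν : ν ≠ 0) {u : BoxMode ν → ℂ} {c d : ℂ} (hc : IteratedLim u c)
    (hd : IteratedLim u d) : c = d := by
  obtain ⟨v, hv, hv'⟩ := hc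
  obtain ⟨w, hw, hw'⟩ := hd
  have : NeZero ν := ⟨hν⟩
  have : Nontrivial (Momentum ν) := inferInstance
  have : (𝓝[≠] (0 : Momentum ν)).NeBot := Module.punctured_nhds_neBot ℝ (Momentum ν) 0
  refine tendsto_nhds_unique_of_eventuallyEq hv' hw' ?_
  filter_upwards [self_mem_nhdsWithin] with q hq
  exact tendsto_nhds_unique (hv q hq) (hw q hq)

theorem form_self_eq_zero_iff (x : Test ν) : form x x = 0 ↔ amplitude x = 0 := by
  simp [form]

theorem iteratedLim_densityFluct_sub_orderFluct_sq {ρ₀ : ℝ} (hρ₀ : 0 < ρ₀) (f : TestFun ν) :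
    IteratedLim
      (fun p => groundState ((densityFluct ρ₀ f.1 p - orderFluct ρ₀ (J f.1) p) ^ 2)) 0 := by
  refine ⟨fun _ => 0, fun q hq => tendsto_const_nhds.congr' ?_, tendsto_const_nhds⟩
  filter_upwards [eventually_mode_ne hq, eventually_size_pos q, eventually_momentum_ne hq]
    with p hp hL hp'
  rw [groundState, pow_two, Module.End.mul_apply, LinearMap.sub_apply _ _ (vacuum ν),
    densityFluct_eq hρ₀ f hL hp, orderFluct_J_eq ρ₀ f hp hp', LinearMap.add_apply, hopping_vacuum,
    add_zero, sub_self, LinearMap.map_zero, Finsupp.zero_apply]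

/-! ## The fields -/

/-- The vector `π(W(x)) Ω` of the GNS space. -/
def weylVec (x : Test ν) : GNS ν := ((toPreGNS (weyl x) : PreGNS ν) : GNS ν)

theorem gnsRep_coe (a b : FluctAlg ν) :
    gnsRep a ((toPreGNS b : PreGNS ν) : GNS ν) = ((toPreGNS (a * b) : PreGNS ν) : GNS ν) :=
  ContinuousLinearMap.completion_apply_coe _ _

theorem gnsRep_weylVec (x y : Test ν) :
    gnsRep (weyl x) (weylVec y) = CCR.phase (sympForm ν) x y • weylVec (x + y) := by
  rw [weylVec, gnsRep_coe, CCR.W_mul_W, map_smul, UniformSpace.Completion.coe_smul, weylVec]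

theorem inner_weylVec (x y : Test ν) :
    inner ℂ (weylVec x) (weylVec y) = Complex.exp (-(1 / 2) * (symForm x x : ℂ) -
      1 / 2 * (symForm y y : ℂ) + form x y) := by
  rw [weylVec, weylVec, UniformSpace.Completion.inner_coe]
  change macroState ν (star (weyl x) * weyl y) = _
  rw [CCR.star_W, CCR.W_mul_W, map_smul, macroState_weyl, CCR.phase, smul_eq_mul,
    ← Complex.exp_add]
  congr 1
  apply Complex.ext <;> simp [symForm, form, sympForm_apply] <;> ring

/-- All inner products of Weyl vectors are functions of the amplitudes, so the difference has norm
zero. -/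
theorem weylVec_congr {x y : Test ν} (h : amplitude x = amplitude y) : weylVec x = weylVec y := by
  rw [← sub_eq_zero, ← inner_self_eq_zero (𝕜 := ℂ), inner_sub_sub_self]
  simp only [inner_weylVec, symForm, form, h]
  ring

theorem gnsRep_weyl_congr {x y : Test ν} (h : amplitude x = amplitude y) :
    gnsRep (weyl x) = gnsRep (weyl y) := by
  refine ContinuousLinearMap.ext fun ψ => ?_
  induction ψ using UniformSpace.Completion.induction_on with
  | hp => exact isClosed_eq (gnsRep _).continuous (gnsRep _).continuous
  | ih b =>
    obtain ⟨b, rfl⟩ := toPreGNS.surjective b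
    induction b using CCR.induction_on with
    | zero => rw [map_zero, UniformSpace.Completion.coe_zero, map_zero, map_zero]
    | add a b ha hb =>
      rw [map_add, UniformSpace.Completion.coe_add, map_add, map_add, ha, hb]
    | smul z u =>
      rw [map_smul, UniformSpace.Completion.coe_smul, map_smul, map_smul]
      change z • gnsRep (weyl x) (weylVec u) = z • gnsRep (weyl y) (weylVec u)
      rw [gnsRep_weylVec, gnsRep_weylVec, weylVec_congr (x := x + u) (y := y + u) (by simp [h])]
      simp [CCR.phase, sympForm_apply, form, h]

theorem field_congr {x y : Test ν} (h : amplitude x = amplitude y) : field x = field y := by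
  have hW : ∀ t : ℝ, gnsRep (weyl (t • x)) = gnsRep (weyl (t • y)) := fun t =>
    gnsRep_weyl_congr (by simp [h])
  refine LinearPMap.ext (Submodule.ext fun ψ => ?_) fun ψ hx hy => ?_
  · change DifferentiableAt ℝ (fun t : ℝ => gnsRep (weyl (t • x)) ψ) 0 ↔
      DifferentiableAt ℝ (fun t : ℝ => gnsRep (weyl (t • y)) ψ) 0
    simp only [hW]
  · change -Complex.I • deriv (fun t : ℝ => gnsRep (weyl (t • x)) ψ) 0 =
      -Complex.I • deriv (fun t : ℝ => gnsRep (weyl (t • y)) ψ) 0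
    simp only [hW]

/-! ### Differentiability of the Weyl orbit of the cyclic vector -/

theorem gnsRep_weylVec_zero (x : Test ν) : gnsRep (weyl x) (weylVec 0) = weylVec x := by
  rw [gnsRep_weylVec]
  simp [CCR.phase]

theorem inner_weylVec_smul (x : Test ν) (s t : ℝ) :
    inner ℂ (weylVec (s • x)) (weylVec (t • x)) =
      ((Real.exp (-(symForm x x / 2) * s ^ 2) * Real.exp (-(symForm x x / 2) * t ^ 2) *
        Real.exp (symForm x x * (s * t)) : ℝ) : ℂ) := by
  rw [inner_weylVec, ← Real.exp_add, ← Real.exp_add, Complex.ofReal_exp]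
  congr 1
  apply Complex.ext <;> simp [symForm, form, pow_two] <;> ring

theorem tendsto_slope_exp (a : ℝ) :
    Tendsto (fun t : ℝ => t⁻¹ * (Real.exp (a * t) - 1)) (𝓝[≠] 0) (𝓝 a) := by
  have h : HasDerivAt (fun t : ℝ => Real.exp (a * t)) a 0 := by
    simpa using ((hasDerivAt_id (0 : ℝ)).const_mul a).exp
  simpa [slope_fun_def] using hasDerivAt_iff_tendsto_slope.1 h

theorem tendsto_slope_exp_sq (a : ℝ) :
    Tendsto (fun t : ℝ => t⁻¹ * (Real.exp (a * t ^ 2) - 1)) (𝓝[≠] 0) (𝓝 0) := by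
  have h : HasDerivAt (fun t : ℝ => Real.exp (a * t ^ 2)) 0 0 := by
    simpa using (((hasDerivAt_id (0 : ℝ)).pow 2).const_mul a).exp
  simpa [slope_fun_def] using hasDerivAt_iff_tendsto_slope.1 h

theorem tendsto_inner_slope_weylVec (x : Test ν) :
    Tendsto (fun p : ℝ × ℝ => inner ℂ (slope (fun t : ℝ => weylVec (t • x)) 0 p.1)
      (slope (fun t : ℝ => weylVec (t • x)) 0 p.2)) (𝓝[≠] 0 ×ˢ 𝓝[≠] 0)
      (𝓝 (symForm x x : ℂ)) := by
  set a := symForm x x with ha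
  have hE : Tendsto (fun t : ℝ => Real.exp (-(a / 2) * t ^ 2)) (𝓝[≠] 0) (𝓝 1) := by
    have : Continuous fun t : ℝ => Real.exp (-(a / 2) * t ^ 2) := by fun_prop
    simpa using (this.tendsto 0).mono_left nhdsWithin_le_nhds
  have hmul : Tendsto (fun p : ℝ × ℝ => p.1 * p.2) (𝓝[≠] 0 ×ˢ 𝓝[≠] 0) (𝓝[≠] 0) := by
    refine tendsto_nhdsWithin_iff.2 ⟨?_, ?_⟩
    · have h1 : Tendsto (fun p : ℝ × ℝ => p.1) (𝓝[≠] 0 ×ˢ 𝓝[≠] 0) (𝓝 0) :=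
        (tendsto_fst (f := 𝓝[≠] (0 : ℝ))).mono_right nhdsWithin_le_nhds
      have h2 : Tendsto (fun p : ℝ × ℝ => p.2) (𝓝[≠] 0 ×ˢ 𝓝[≠] 0) (𝓝 0) :=
        (tendsto_snd (g := 𝓝[≠] (0 : ℝ))).mono_right nhdsWithin_le_nhds
      simpa using h1.mul h2
    · filter_upwards [prod_mem_prod self_mem_nhdsWithin self_mem_nhdsWithin] with p hp
      exact mul_ne_zero hp.1 hp.2
  have hs := tendsto_slope_exp_sq (-(a / 2))
  -- With `E_s = exp(-a s²/2)`, the second difference `E_s E_t exp(a s t) - E_s - E_t + 1` equals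
  -- `E_s E_t (exp(a s t) - 1) + (E_s - 1)(E_t - 1)`. Divided by `s t`, the first summand tends to
  -- `a` and the second to `0`.
  have h : Tendsto (fun p : ℝ × ℝ => Real.exp (-(a / 2) * p.1 ^ 2) *
      Real.exp (-(a / 2) * p.2 ^ 2) * ((p.1 * p.2)⁻¹ * (Real.exp (a * (p.1 * p.2)) - 1)) +
      (p.1⁻¹ * (Real.exp (-(a / 2) * p.1 ^ 2) - 1)) *
        (p.2⁻¹ * (Real.exp (-(a / 2) * p.2 ^ 2) - 1))) (𝓝[≠] 0 ×ˢ 𝓝[≠] 0) (𝓝 a) := by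
    simpa using (((hE.comp tendsto_fst).mul (hE.comp tendsto_snd)).mul
      ((tendsto_slope_exp a).comp hmul)).add ((hs.comp tendsto_fst).mul (hs.comp tendsto_snd))
  refine ((Complex.continuous_ofReal.tendsto a).comp h).congr fun p => ?_
  rw [slope_def_module, slope_def_module, sub_zero, sub_zero, ← Complex.coe_smul,
    ← Complex.coe_smul, inner_smul_left, inner_smul_right, inner_sub_left, inner_sub_right,
    inner_sub_right]
  simp only [inner_weylVec_smul, ← ha, Complex.conj_ofReal, Function.comp_apply]
  norm_cast
  simp
  ring

/-- The Gram kernel of the difference quotients has a joint limit as both parameters tend to `0`.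
Expanding `‖D s - D t‖²` then shows that the quotients are Cauchy, and the GNS space is complete. -/
theorem differentiableAt_weylVec (x : Test ν) :
    DifferentiableAt ℝ (fun t : ℝ => weylVec (t • x)) 0 := by
  set D := slope (fun t : ℝ => weylVec (t • x)) 0 with hD
  have hG := tendsto_inner_slope_weylVec x
  have h1 := hG.comp ((tendsto_fst (f := 𝓝[≠] (0 : ℝ)) (g := 𝓝[≠] (0 : ℝ))).prodMk tendsto_fst)
  have h2 := hG.comp ((tendsto_snd (f := 𝓝[≠] (0 : ℝ)) (g := 𝓝[≠] (0 : ℝ))).prodMk tendsto_snd)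
  have h3 := hG.comp ((tendsto_snd (f := 𝓝[≠] (0 : ℝ)) (g := 𝓝[≠] (0 : ℝ))).prodMk tendsto_fst)
  have h4 := (Complex.continuous_re.tendsto _).comp (((h1.sub hG).sub h3).add h2)
  have h5 : Tendsto (fun p : ℝ × ℝ => dist (D p.1) (D p.2)) (𝓝[≠] 0 ×ˢ 𝓝[≠] 0) (𝓝 0) := by
    have h6 := (Real.continuous_sqrt.tendsto _).comp h4
    simp only [sub_self, zero_sub, neg_add_cancel, Complex.zero_re, Real.sqrt_zero] at h6
    refine h6.congr fun p => ?_
    rw [dist_eq_norm, @norm_eq_sqrt_re_inner ℂ, inner_sub_sub_self]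
    rfl
  have hC : Cauchy (map D (𝓝[≠] 0)) :=
    cauchy_map_iff.2 ⟨inferInstance, tendsto_uniformity_iff_dist_tendsto_zero.2 h5⟩
  obtain ⟨d, hd⟩ := cauchy_map_iff_exists_tendsto.1 hC
  exact (hasDerivAt_iff_tendsto_slope.2 hd).differentiableAt

theorem inner_deriv_weylVec (u x : Test ν) :
    inner ℂ (weylVec u) (deriv (fun t : ℝ => weylVec (t • x)) 0) =
      Complex.exp (-(1 / 2) * (symForm u u : ℂ)) * form u x := by
  have h1 : HasDerivAt (fun t : ℝ => inner ℂ (weylVec u) (weylVec (t • x)))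
      (inner ℂ (weylVec u) (deriv (fun t : ℝ => weylVec (t • x)) 0)) 0 :=
    ((innerSL ℂ (weylVec u)).restrictScalars ℝ).hasFDerivAt.comp_hasDerivAt 0
      (differentiableAt_weylVec x).hasDerivAt
  have e : (fun t : ℝ => inner ℂ (weylVec u) (weylVec (t • x))) = fun t : ℝ =>
      Complex.exp (-(1 / 2) * (symForm u u : ℂ) - 1 / 2 * (symForm x x : ℂ) * (t : ℂ) ^ 2 +
        form u x * t) := by
    funext t
    rw [inner_weylVec]
    congr 1
    apply Complex.ext <;> simp [symForm, form, pow_two] <;> ring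
  rw [e] at h1
  have hs : HasDerivAt (fun s : ℝ => (s : ℂ)) 1 0 := Complex.ofRealCLM.hasDerivAt
  have h2 := ((((hs.pow 2).const_mul (1 / 2 * (symForm x x : ℂ))).const_sub
    (-(1 / 2) * (symForm u u : ℂ))).add (hs.const_mul (form u x))).cexp
  refine h1.unique (h2.congr_deriv ?_)
  simp

theorem amplitude_eq_of_field_eq {x y : Test ν} (h : field x = field y) :
    amplitude x = amplitude y := by
  have hdom : ∀ z : Test ν, weylVec 0 ∈ (field z).domain := fun z => by
    change DifferentiableAt ℝ (fun t : ℝ => gnsRep (weyl (t • z)) (weylVec 0)) 0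
    simpa only [gnsRep_weylVec_zero] using differentiableAt_weylVec z
  have hval : ∀ z : Test ν, field z ⟨weylVec 0, hdom z⟩ =
      -Complex.I • deriv (fun t : ℝ => weylVec (t • z)) 0 := fun z => by
    change -Complex.I • deriv (fun t : ℝ => gnsRep (weyl (t • z)) (weylVec 0)) 0 = _
    simp only [gnsRep_weylVec_zero]
  have hd : deriv (fun t : ℝ => weylVec (t • x)) 0 = deriv (fun t : ℝ => weylVec (t • y)) 0 := by
    have := @(LinearPMap.ext_iff.1 h).2 (weylVec 0) (hdom x) (hdom y)
    rw [hval, hval] at this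
    exact smul_right_injective _ (neg_ne_zero.2 Complex.I_ne_zero) this
  -- Testing with the Weyl vector of `x - y` itself gives `⟨x - y | x - y⟩ = 0`.
  have hf : form (x - y) x = form (x - y) y := by
    refine mul_left_cancel₀ (Complex.exp_ne_zero (-(1 / 2) * (symForm (x - y) (x - y) : ℂ))) ?_
    rw [← inner_deriv_weylVec, ← inner_deriv_weylVec, hd]
  have h0 : form (x - y) (x - y) = 0 := by
    have e : form (x - y) (x - y) = form (x - y) x - form (x - y) y := by
      simp only [form, map_sub]
      ring
    rw [e, hf, sub_self]
  rw [form_self_eq_zero_iff, map_sub] at h0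
  exact sub_eq_zero.1 h0

end BoseFluctuation

end

theorem mainTheorem7 (ν : ℕ) (hν : 3 ≤ ν) (ρ₀ : ℝ) (hρ₀ : 0 < ρ₀) :
    (∀ x y : Test ν,
      IteratedLim (fun p => groundState (fluct ρ₀ x p * fluct ρ₀ y p)) (form x y)) ∧
    (∀ x y : Test ν,
      field x = field y ↔
        IteratedLim (fun p => groundState (fluct ρ₀ (x - y) p ^ 2)) 0) ∧
    (∀ f : TestFun ν,
      IteratedLim
        (fun p => groundState ((densityFluct ρ₀ f.1 p - orderFluct ρ₀ (J f.1) p) ^ 2)) 0 ∧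
      IsCLTLimit ρ₀ (densityFluct ρ₀ f.1) (f, 0) ∧
      IsCLTLimit ρ₀ (orderFluct ρ₀ (J f.1)) (f, 0)) := by
  have hν' : ν ≠ 0 := by omega
  refine ⟨iteratedLim_fluct_mul_fluct hρ₀, fun x y => ?_, fun f =>
    ⟨iteratedLim_densityFluct_sub_orderFluct_sq hρ₀ f,
      isCLTLimit_of_isAsympLinear hρ₀ hν' fun q => isAsympLinear_densityFluct hρ₀ hν' f,
      isCLTLimit_of_isAsympLinear hρ₀ hν' fun q => isAsympLinear_orderFluct_J ρ₀ f⟩⟩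
  have hlim := iteratedLim_fluct_mul_fluct hρ₀ (x - y) (x - y)
  simp only [← pow_two] at hlim
  constructor
  · intro h
    have h0 : form (x - y) (x - y) = 0 := by
      rw [form_self_eq_zero_iff, map_sub, amplitude_eq_of_field_eq h, sub_self]
    rwa [h0] at hlim
  · intro h
    -- The same iterated limit equals `⟨x - y | x - y⟩` by the two-point computation, so uniqueness
    -- forces this to be zero.
    have h0 := hlim.unique hν' h
    rw [form_self_eq_zero_iff, map_sub] at h0
    exact field_congr (sub_eq_zero.1 h0)
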